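/- Let $F:\mathcal C\rightleftarrows\mathcal D:U$ be a Quillen pair between stable model categories with small coproducts (a pointed model category is stable if the suspension functor is an equivalence of its homotopy category, which is then triangulated, with exact triangles given by the cofiber sequences). A set $\mathcal P$ of objects is a set of generators if the only full triangulated subcategory of the homotopy category that is closed under coproducts and contains $\mathcal P$ is the whole homotopy category; an object $X$ is homotopically compact if for every family $\{A_i\}_{i\in I}$ of objects the canonical map $\bigoplus_{i\in I}[X,A_i]\to[X,\coprod_{i\in I}A_i]$ of groups of morphisms in the homotopy category is an isomorphism. Let $\mathcal K$ and $\mathcal L$ be sets of homotopically compact generators of $\mathcal C$ and $\mathcal D$ respectively, and let $LF$ and $RU$ be the total left and right derived functors of $F$ and $U$. 1. $RU:\mathrm{Ho}(\mathcal D)\to\mathrm{Ho}(\mathcal C)$ preserves coproducts if and only if $LF(k)$ is homotopically compact for every $k\in\mathcal K$. 2. Suppose that $RU$ preserves coproducts (equivalently, that $LF$ sends every $k\in\mathcal K$ to a homotopically compact object). Write $Q$ and $R$ for cofibrant and fibrant replacement. If the derived unit $Qk\to U R F Q k$ is a weak equivalence in $\mathcal C$ for every $k\in\mathcal K$, and the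 derived counit $F Q U R l\to R l$ is a weak equivalence in $\mathcal D$ for every $l\in\mathcal L$, then $(F,U)$ is a Quillen equivalence. -/

import Mathlib

open CategoryTheory Limits HomotopicalAlgebra
open scoped DirectSum

universe w v u v' u'

noncomputable section

namespace StableModel

section Homotopy

variable (C : Type u) [Category.{v} C] [ModelCategory C]

/-- The homotopy category of a model category: the localization at the weak equivalences. -/
abbrev Ho := (weakEquivalences C).Localization

/-- The localization functor from a model category to its homotopy category. -/
abbrev toHo : C ⥤ Ho C := (weakEquivalences C).Q

variable {C}

lemma isIso_toHo_map {X Y : C} (f : X ⟶ Y) [WeakEquivalence f] : IsIso ((toHo C).map f) :=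
  Localization.inverts (toHo C) (weakEquivalences C) f (mem_weakEquivalences f)

/-- Ken Brown's lemma: a functor on cofibrant objects which inverts the
trivial cofibrations inverts all weak equivalences. -/
lemma isInvertedBy_of_trivialCofibration {E : Type*} [Category* E] (G : CofibrantObject C ⥤ E)
    (hG : ∀ (X Y : CofibrantObject C) (f : X ⟶ Y), Cofibration f.hom → WeakEquivalence f.hom →
      IsIso (G.map f)) :
    (weakEquivalences (CofibrantObject C)).IsInvertedBy G := by
  intro X Y f hf
  have hw : WeakEquivalence f.hom := by
    rwa [← weakEquivalence_iff_of_objectProperty, weakEquivalence_iff]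
  obtain ⟨h⟩ : Nonempty (CofibrantBrownFactorization f.hom) := inferInstance
  have hZ : IsCofibrant h.Z := isCofibrant_of_cofibration h.i
  let Z : CofibrantObject C := CofibrantObject.mk h.Z
  let i : X ⟶ Z := ⟨h.i⟩
  let p : Z ⟶ Y := ⟨h.p⟩
  let s : Y ⟶ Z := ⟨h.s⟩
  have hi : IsIso (G.map i) := hG _ _ _ (by dsimp [i]; infer_instance) (by dsimp [i]; infer_instance)
  have hs : IsIso (G.map s) := hG _ _ _ (by dsimp [s]; infer_instance) (by dsimp [s]; infer_instance)
  have hsp : s ≫ p = 𝟙 Y := by ext; exact h.s_p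
  have hip : i ≫ p = f := by ext; exact h.fac
  have hp : IsIso (G.map p) := by
    have : IsIso (G.map s ≫ G.map p) := by
      rw [← G.map_comp, hsp, CategoryTheory.Functor.map_id]; infer_instance
    exact IsIso.of_isIso_comp_left (G.map s) (G.map p)
  rw [← hip, G.map_comp]
  infer_instance

/-- The dual statement: a functor on fibrant objects which inverts the
trivial fibrations inverts all weak equivalences. -/
lemma isInvertedBy_of_trivialFibration {E : Type*} [Category* E] (G : FibrantObject C ⥤ E)
    (hG : ∀ (X Y : FibrantObject C) (f : X ⟶ Y), Fibration f.hom → WeakEquivalence f.hom →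
      IsIso (G.map f)) :
    (weakEquivalences (FibrantObject C)).IsInvertedBy G := by
  intro X Y f hf
  have hw : WeakEquivalence f.hom := by
    rwa [← weakEquivalence_iff_of_objectProperty, weakEquivalence_iff]
  obtain ⟨h⟩ : Nonempty (FibrantBrownFactorization f.hom) := inferInstance
  have hZ : IsFibrant h.Z := isFibrant_of_fibration h.p
  let Z : FibrantObject C := FibrantObject.mk h.Z
  let i : X ⟶ Z := ⟨h.i⟩
  let p : Z ⟶ Y := ⟨h.p⟩
  let r : Z ⟶ X := ⟨h.r⟩
  have hp : IsIso (G.map p) := hG _ _ _ (by dsimp [p]; infer_instance) (by dsimp [p]; infer_instance)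
  have hr : IsIso (G.map r) := hG _ _ _ (by dsimp [r]; infer_instance) (by dsimp [r]; infer_instance)
  have hir : i ≫ r = 𝟙 X := by ext; exact h.i_r
  have hip : i ≫ p = f := by ext; exact h.fac
  have hi : IsIso (G.map i) := by
    have : IsIso (G.map i ≫ G.map r) := by
      rw [← G.map_comp, hir, CategoryTheory.Functor.map_id]; infer_instance
    exact IsIso.of_isIso_comp_right (G.map i) (G.map r)
  rw [← hip, G.map_comp]
  infer_instance

end Homotopy

/-- Quotienting `A ⟶ B ⟶ T` by `A` gives a pushout square. -/
lemma isPushout_cokernel_map {C : Type u} [Category.{v} C] [HasZeroMorphisms C] [HasCokernels C]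
    {A B T : C} (i : A ⟶ B) (j : B ⟶ T) (k : A ⟶ T) (hk : k = i ≫ j) :
    IsPushout j (cokernel.π i) (cokernel.π k)
      (cokernel.map i k (𝟙 A) j (by simp [hk])) := by
  subst hk
  refine ⟨⟨by simp⟩, ⟨PushoutCocone.IsColimit.mk _
    (fun s => cokernel.desc _ s.inl (by
      rw [Category.assoc, s.condition, cokernel.condition_assoc, zero_comp])) ?_ ?_ ?_⟩⟩
  · intro s; simp
  · intro s
    rw [← cancel_epi (cokernel.π i)]
    simpa using s.condition
  · intro s m h₁ h₂
    rw [← cancel_epi (cokernel.π (i ≫ j))]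
    simpa using h₁

lemma weakEquivalence_cokernel_map {C : Type u} [Category.{v} C] [ModelCategory C]
    [HasZeroMorphisms C] {A B T : C} (i : A ⟶ B) (j : B ⟶ T) (k : A ⟶ T)
    (hk : k = i ≫ j) [Cofibration j] [WeakEquivalence j] :
    WeakEquivalence (cokernel.map i k (𝟙 A) j (by simp [hk])) := by
  rw [weakEquivalence_iff]
  exact (MorphismProperty.of_isPushout (P := trivialCofibrations C)
    (isPushout_cokernel_map i j k hk).flip (mem_trivialCofibrations j)).2

section Suspension

variable {C : Type u} [Category.{v} C] [ModelCategory C] [HasZeroObject C] [HasZeroMorphisms C]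

open ZeroObject

/-- A factorization of `X ⟶ 0` as a cofibration followed by a trivial fibration. -/
def coneData (X : C) :
    MorphismProperty.MapFactorizationData (cofibrations C) (trivialFibrations C)
      (0 : X ⟶ (0 : C)) :=
  MorphismProperty.factorizationData _ _ _

/-- The cone on `X`: a weakly contractible object containing `X` by a cofibration. -/
abbrev cone (X : C) : C := (coneData X).Z

/-- The inclusion of `X` in its cone. -/
def coneι (X : C) : X ⟶ cone X := (coneData X).i

instance (X : C) : Cofibration (coneι X) := by dsimp only [coneι]; infer_instance

/-- A morphism to zero is a trivial fibration. -/
def IsContractibleFibrant (T : C) : Prop :=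
  Fibration (0 : T ⟶ (0 : C)) ∧ WeakEquivalence (0 : T ⟶ (0 : C))

lemma isContractibleFibrant_cone (X : C) : IsContractibleFibrant (cone X) := by
  have h : (coneData X).p = 0 := (isZero_zero C).eq_of_tgt _ _
  refine ⟨?_, ?_⟩ <;> rw [← h] <;> infer_instance

lemma exists_extension {A B T : C} (i : A ⟶ B) [Cofibration i] (g : A ⟶ T)
    (hT : IsContractibleFibrant T) : ∃ e : B ⟶ T, i ≫ e = g := by
  have := hT.1
  have := hT.2
  have sq : CommSq g i (0 : T ⟶ (0 : C)) 0 := ⟨by simp⟩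
  exact ⟨sq.lift, sq.fac_left⟩

/-- A morphism extended to cones. -/
def coneMap {X Y : C} (f : X ⟶ Y) : cone X ⟶ cone Y :=
  (exists_extension (coneι X) (f ≫ coneι Y) (isContractibleFibrant_cone Y)).choose

lemma coneι_coneMap {X Y : C} (f : X ⟶ Y) : coneι X ≫ coneMap f = f ≫ coneι Y :=
  (exists_extension (coneι X) (f ≫ coneι Y) (isContractibleFibrant_cone Y)).choose_spec

/-- The quotient of the cone on `X` by `X`. -/
abbrev suspObj (X : C) : C := cokernel (coneι X)

/-- The morphism induced by a morphism on the quotients of the cones. -/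
def suspMap {X Y : C} (f : X ⟶ Y) : suspObj X ⟶ suspObj Y :=
  cokernel.map _ _ f (coneMap f) (coneι_coneMap f)

/-- Two extensions of the same morphism to a contractible target agree on quotients
in the homotopy category. -/
lemma toHo_map_cokernel_map_eq {X Y E T : C} (i : X ⟶ E) (t : Y ⟶ T) (f : X ⟶ Y)
    [Cofibration i] (hT : IsContractibleFibrant T) (a b : E ⟶ T)
    (ha : i ≫ a = f ≫ t) (hb : i ≫ b = f ≫ t) :
    (toHo C).map (cokernel.map i t f a ha) = (toHo C).map (cokernel.map i t f b hb) := by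
  let h := MorphismProperty.factorizationData (cofibrations C) (trivialFibrations C)
    (pushout.desc (𝟙 E) (𝟙 E) rfl : pushout i i ⟶ E)
  let j₀ : E ⟶ h.Z := pushout.inl i i ≫ h.i
  let j₁ : E ⟶ h.Z := pushout.inr i i ≫ h.i
  have hj₀ : j₀ ≫ h.p = 𝟙 E := by
    rw [Category.assoc, h.fac, pushout.inl_desc]
  have hj₁ : j₁ ≫ h.p = 𝟙 E := by
    rw [Category.assoc, h.fac, pushout.inr_desc]
  have : Cofibration j₀ := by dsimp [j₀]; infer_instance
  have : WeakEquivalence j₀ := weakEquivalence_of_postcomp_of_fac hj₀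
  have hij : i ≫ j₀ = i ≫ j₁ := by simp [j₀, j₁, pushout.condition_assoc]
  obtain ⟨H, hH⟩ := exists_extension h.i (pushout.desc a b (ha.trans hb.symm)) hT
  have hHa : j₀ ≫ H = a := by
    rw [Category.assoc, hH, pushout.inl_desc]
  have hHb : j₁ ≫ H = b := by
    rw [Category.assoc, hH, pushout.inr_desc]
  let k : X ⟶ h.Z := i ≫ j₀
  let J₀ : cokernel i ⟶ cokernel k := cokernel.map i k (𝟙 X) j₀ (by simp [k])
  let J₁ : cokernel i ⟶ cokernel k := cokernel.map i k (𝟙 X) j₁ (by simp [k, hij])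
  let P : cokernel k ⟶ cokernel i := cokernel.map k i (𝟙 X) h.p (by simp [k, hj₀])
  let K : cokernel k ⟶ cokernel t := cokernel.map k t f H (by simp [k, hHa, ha])
  have hw : WeakEquivalence J₀ := weakEquivalence_cokernel_map i j₀ k rfl
  have h₀ : J₀ ≫ P = 𝟙 _ := by
    rw [← cancel_epi (cokernel.π i)]
    simp [J₀, P, reassoc_of% hj₀]
  have h₁ : J₁ ≫ P = 𝟙 _ := by
    rw [← cancel_epi (cokernel.π i)]
    simp [J₁, P, reassoc_of% hj₁]
  have ea : J₀ ≫ K = cokernel.map i t f a ha := by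
    rw [← cancel_epi (cokernel.π i)]
    simp [J₀, K, reassoc_of% hHa]
  have eb : J₁ ≫ K = cokernel.map i t f b hb := by
    rw [← cancel_epi (cokernel.π i)]
    simp [J₁, K, reassoc_of% hHb]
  have : IsIso ((toHo C).map J₀) := isIso_toHo_map J₀
  have hP : IsIso ((toHo C).map P) := by
    have : IsIso ((toHo C).map J₀ ≫ (toHo C).map P) := by
      rw [← Functor.map_comp, h₀, CategoryTheory.Functor.map_id]; infer_instance
    exact IsIso.of_isIso_comp_left ((toHo C).map J₀) ((toHo C).map P)
  have hJ : (toHo C).map J₀ = (toHo C).map J₁ := by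
    rw [← cancel_mono ((toHo C).map P), ← Functor.map_comp, ← Functor.map_comp, h₀, h₁]
  rw [← ea, ← eb, Functor.map_comp, Functor.map_comp, hJ]

lemma toHo_map_suspMap {X Y : C} (f : X ⟶ Y) (a : cone X ⟶ cone Y)
    (ha : coneι X ≫ a = f ≫ coneι Y) :
    (toHo C).map (suspMap f) = (toHo C).map (cokernel.map _ _ f a ha) :=
  toHo_map_cokernel_map_eq _ _ f (isContractibleFibrant_cone Y) _ _
    (coneι_coneMap f) ha

variable (C) in
/-- The suspension on cofibrant objects, with values in the homotopy category:
`X` is sent to the quotient `cone X / X`, and `f : X ⟶ Y` to the class of the morphism induced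
by any extension of `f` to the cones. -/
def suspCof : CofibrantObject C ⥤ Ho C where
  obj X := (toHo C).obj (suspObj X.obj)
  map f := (toHo C).map (suspMap f.hom)
  map_id X := by
    rw [toHo_map_suspMap _ (𝟙 _) (by simp), ← CategoryTheory.Functor.map_id (toHo C)]
    congr 1
    rw [← cancel_epi (cokernel.π (coneι X.obj))]
    simp
  map_comp {X Y Z} f g := by
    rw [toHo_map_suspMap _ (coneMap f.hom ≫ coneMap g.hom)
      (by simp [coneι_coneMap, reassoc_of% coneι_coneMap f.hom]), ← (toHo C).map_comp]
    congr 1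
    rw [← cancel_epi (cokernel.π (coneι X.obj))]
    simp [suspMap]

lemma isIso_toHo_map_suspMap {X Y : C} (f : X ⟶ Y) [Cofibration f] [WeakEquivalence f] :
    IsIso ((toHo C).map (suspMap f)) := by
  let E := pushout (coneι X) f
  let h := MorphismProperty.factorizationData (trivialCofibrations C) (fibrations C)
    (0 : E ⟶ (0 : C))
  let y : Y ⟶ E := pushout.inr _ _
  let t : Y ⟶ h.Z := y ≫ h.i
  have : Cofibration y := by dsimp [y, E]; infer_instance
  have : Cofibration t := by dsimp [t]; infer_instance
  let c : cone X ⟶ h.Z := pushout.inl _ _ ≫ h.i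
  have : WeakEquivalence (pushout.inl (coneι X) f) := inferInstance
  have : WeakEquivalence c := by dsimp only [c]; infer_instance
  have hp : h.p = 0 := (isZero_zero C).eq_of_tgt _ _
  have hZ : IsContractibleFibrant h.Z := by
    refine ⟨by rw [← hp]; infer_instance, ?_⟩
    have := (isContractibleFibrant_cone X).2
    exact weakEquivalence_of_precomp_of_fac (f := c) (g := 0) (fg := 0) (by simp)
  have hc : coneι X ≫ c = f ≫ t := by
    simp [c, t, y, E, pushout.condition_assoc]
  obtain ⟨r, hr⟩ := exists_extension t (coneι Y) (isContractibleFibrant_cone Y)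
  obtain ⟨s, hs⟩ := exists_extension (coneι Y) t hZ
  let φ : suspObj X ⟶ cokernel t := cokernel.map _ _ f c hc
  let R : cokernel t ⟶ suspObj Y := cokernel.map _ _ (𝟙 Y) r (by simp [hr])
  let S : suspObj Y ⟶ cokernel t := cokernel.map _ _ (𝟙 Y) s (by simp [hs])
  have hR : IsIso ((toHo C).map R) := by
    refine ⟨(toHo C).map S, ?_, ?_⟩
    · have e : R ≫ S = cokernel.map t t (𝟙 Y) (r ≫ s) (by simp [reassoc_of% hr, hs]) := by
        rw [← cancel_epi (cokernel.π t)]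
        simp [R, S]
      rw [← Functor.map_comp, e,
        toHo_map_cokernel_map_eq t t (𝟙 Y) hZ (r ≫ s) (𝟙 _) _ (by simp), ← CategoryTheory.Functor.map_id]
      congr 1
      rw [← cancel_epi (cokernel.π t)]
      simp
    · have e : S ≫ R = cokernel.map (coneι Y) (coneι Y) (𝟙 Y) (s ≫ r)
          (by simp [reassoc_of% hs, hr]) := by
        rw [← cancel_epi (cokernel.π (coneι Y))]
        simp [R, S]
      rw [← Functor.map_comp, e,
        toHo_map_cokernel_map_eq (coneι Y) (coneι Y) (𝟙 Y) (isContractibleFibrant_cone Y)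
          (s ≫ r) (𝟙 _) _ (by simp), ← CategoryTheory.Functor.map_id]
      congr 1
      rw [← cancel_epi (cokernel.π (coneι Y))]
      simp
  have hφ : IsIso ((toHo C).map φ) := by
    let φ₁ : suspObj X ⟶ cokernel y :=
      cokernel.map _ _ f (pushout.inl _ _) pushout.condition
    let φ₂ : cokernel y ⟶ cokernel t := cokernel.map y t (𝟙 Y) h.i (by simp [t])
    have h₁ : IsIso φ₁ :=
      isIso_cokernel_map_of_isPushout (IsPushout.of_hasPushout (coneι X) f)
    have h₂ : WeakEquivalence φ₂ := weakEquivalence_cokernel_map y h.i t rfl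
    have := isIso_toHo_map φ₂
    have e : φ = φ₁ ≫ φ₂ := by
      rw [← cancel_epi (cokernel.π (coneι X))]
      simp [φ, φ₁, φ₂, c]
    rw [e, Functor.map_comp]
    infer_instance
  have e : φ ≫ R = cokernel.map _ _ f (c ≫ r) (by rw [reassoc_of% hc, hr]) := by
    rw [← cancel_epi (cokernel.π (coneι X))]
    simp [φ, R]
  rw [toHo_map_suspMap f (c ≫ r) (by rw [reassoc_of% hc, hr])]
  have e' := congrArg (toHo C).map e
  rw [Functor.map_comp] at e'
  exact e' ▸ inferInstance

variable (C) in
lemma suspCof_inverts : (weakEquivalences (CofibrantObject C)).IsInvertedBy (suspCof C) :=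
  isInvertedBy_of_trivialCofibration _ (fun _ _ f _ _ => isIso_toHo_map_suspMap f.hom)

variable (C) in
/-- The suspension functor on the homotopy category of a pointed model category, induced by
`X ↦ cone X / X` on cofibrant objects. -/
def suspension : Ho C ⥤ Ho C :=
  Localization.lift (suspCof C) (suspCof_inverts C) (CofibrantObject.ι ⋙ toHo C)

variable (C) in
/-- A pointed model category is stable if the suspension functor is an equivalence on the
homotopy category. -/
class IsStable : Prop where
  isEquivalence_suspension : (suspension C).IsEquivalence

/-- A pair of composable morphisms of the homotopy category is a cofiber sequence if it is
isomorphic to `A ⟶ B ⟶ B / A` for a cofibration `A ⟶ B` between cofibrant objects. Up to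
isomorphism the exact triangles of the homotopy category of a stable model category are
these sequences, prolonged by a boundary morphism to the suspension of `A`. -/
def IsCofiberSequence {X Y Z : Ho C} (f : X ⟶ Y) (g : Y ⟶ Z) : Prop :=
  ∃ (A B : C) (i : A ⟶ B) (_ : IsCofibrant A) (_ : Cofibration i)
    (a : X ≅ (toHo C).obj A) (b : Y ≅ (toHo C).obj B) (c : Z ≅ (toHo C).obj (cokernel i)),
    f ≫ b.hom = a.hom ≫ (toHo C).map i ∧
      g ≫ c.hom = b.hom ≫ (toHo C).map (cokernel.π i)

/-- A full subcategory of the homotopy category, given by its class of objects, is localising if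
it is a triangulated subcategory which is closed under coproducts. (The
boundary morphism of an exact triangle plays no role in this condition.) -/
structure IsLocalising (P : ObjectProperty (Ho C)) : Prop where
  zero : ∀ X, IsZero X → P X
  suspension_iff : ∀ X, P ((suspension C).obj X) ↔ P X
  two_of_three₁ : ∀ {X Y Z : Ho C} (f : X ⟶ Y) (g : Y ⟶ Z), IsCofiberSequence f g →
    P Y → P Z → P X
  two_of_three₂ : ∀ {X Y Z : Ho C} (f : X ⟶ Y) (g : Y ⟶ Z), IsCofiberSequence f g →
    P X → P Z → P Y
  two_of_three₃ : ∀ {X Y Z : Ho C} (f : X ⟶ Y) (g : Y ⟶ Z), IsCofiberSequence f g →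
    P X → P Y → P Z
  coproduct : ∀ (I : Type w), P.IsClosedUnderColimitsOfShape (Discrete I)

/-- A set of objects of a stable model category is a set of generators if the only localising
subcategory of the homotopy category that contains it is the whole homotopy category. -/
def IsGeneratingSet (K : Set C) : Prop :=
  ∀ P : ObjectProperty (Ho C), IsLocalising.{w} P → (∀ k ∈ K, P ((toHo C).obj k)) → ∀ X, P X

end Suspension

section Compact

variable {T : Type u} [Category.{v} T]

open Classical in
/-- The canonical map from the direct sum of the groups of morphisms `X ⟶ A i` to the group of
morphisms from `X` to a coproduct (more generally, to the point of a cofan) of the `A i`. -/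
def directSumToHom [Preadditive T] (X : T) {I : Type w} {A : I → T} (c : Cofan A) :
    (⨁ i, (X ⟶ A i)) →+ (X ⟶ c.pt) :=
  DirectSum.toAddMonoid (fun i => Preadditive.rightComp X (c.inj i))

/-- An object of a preadditive category is compact if morphisms from it to any coproduct are the
direct sum of the morphisms to the summands. -/
def IsCompactObject [Preadditive T] (X : T) : Prop :=
  ∀ (I : Type w) (A : I → T) (c : Cofan A), IsColimit c →
    Function.Bijective (directSumToHom X c)

end Compact

/-- An object of a stable model category is homotopically compact if it is compact in the
homotopy category. The homotopy category of a stable model category is additive in exactly one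
way, so that the quantifier over the preadditive structures ranges over one structure only. -/
def IsHomotopicallyCompact {C : Type u} [Category.{v} C] [ModelCategory C] (X : Ho C) : Prop :=
  ∀ _ : Preadditive (Ho C), IsCompactObject.{w} X

section Quillen

variable {C : Type u} [Category.{v} C] [ModelCategory C]
  {D : Type u'} [Category.{v'} D] [ModelCategory D] {F : C ⥤ D} {U : D ⥤ C}

/-- An adjunction `F ⊣ U` between model categories is a Quillen pair if `F` preserves
cofibrations and trivial cofibrations. -/
structure IsQuillenPair (_adj : F ⊣ U) : Prop where
  cofibration_map : ∀ {X Y : C} (f : X ⟶ Y), Cofibration f → Cofibration (F.map f)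
  weakEquivalence_map : ∀ {X Y : C} (f : X ⟶ Y), Cofibration f → WeakEquivalence f →
    WeakEquivalence (F.map f)

/-- A Quillen pair `F ⊣ U` is a Quillen equivalence if, for `X` cofibrant and `Y` fibrant,
a morphism `F X ⟶ Y` is a weak equivalence if and only if its adjunct `X ⟶ U Y` is one. -/
structure IsQuillenEquivalence (adj : F ⊣ U) : Prop where
  isQuillenPair : IsQuillenPair adj
  weakEquivalence_iff : ∀ (X : C) (Y : D), IsCofibrant X → IsFibrant Y → ∀ f : F.obj X ⟶ Y,
    WeakEquivalence f ↔ WeakEquivalence (adj.homEquiv X Y f)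

variable {adj : F ⊣ U}

lemma IsQuillenPair.map_trivialFibration (h : IsQuillenPair adj) {X Y : D} (f : X ⟶ Y)
    [Fibration f] [WeakEquivalence f] : WeakEquivalence (U.map f) := by
  have : trivialFibrations C (U.map f) := by
    rw [← cofibrations_rlp]
    intro A B i hi
    rw [← cofibration_iff] at hi
    rw [← adj.hasLiftingProperty_iff]
    have := h.cofibration_map i hi
    infer_instance
  exact ((mem_trivialFibrations_iff _).1 this).2

lemma IsQuillenPair.left_inverts (h : IsQuillenPair adj) :
    (weakEquivalences (CofibrantObject C)).IsInvertedBy (CofibrantObject.ι ⋙ F ⋙ toHo D) :=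
  isInvertedBy_of_trivialCofibration _ (fun X Y f hf hw => by
    have := h.weakEquivalence_map f.hom hf hw
    exact isIso_toHo_map (F.map f.hom))

lemma IsQuillenPair.right_inverts (h : IsQuillenPair adj) :
    (weakEquivalences (FibrantObject D)).IsInvertedBy (FibrantObject.ι ⋙ U ⋙ toHo C) :=
  isInvertedBy_of_trivialFibration _ (fun X Y f hf hw => by
    have := h.map_trivialFibration f.hom
    exact isIso_toHo_map (U.map f.hom))

/-- The total left derived functor of the left adjoint of a Quillen pair, which is given by `F`
on cofibrant objects. -/
def IsQuillenPair.leftDerived (h : IsQuillenPair adj) : Ho C ⥤ Ho D :=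
  Localization.lift (CofibrantObject.ι ⋙ F ⋙ toHo D) h.left_inverts
    (CofibrantObject.ι ⋙ toHo C)

/-- The total right derived functor of the right adjoint of a Quillen pair, which is given by `U`
on fibrant objects. -/
def IsQuillenPair.rightDerived (h : IsQuillenPair adj) : Ho D ⥤ Ho C :=
  Localization.lift (FibrantObject.ι ⋙ U ⋙ toHo C) h.right_inverts
    (FibrantObject.ι ⋙ toHo D)

/-- Cofibrant replacement `cofRep X`, with its trivial fibration `cofRepHom X : cofRep X ⟶ X`. -/
abbrev cofRep (X : C) : C := CofibrantObject.HoCat.resolutionObj X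

/-- The trivial fibration from the cofibrant replacement. -/
abbrev cofRepHom (X : C) : cofRep X ⟶ X := CofibrantObject.HoCat.pResolutionObj X

/-- Fibrant replacement `fibRep X`, with its trivial cofibration `fibRepHom X : X ⟶ fibRep X`. -/
abbrev fibRep (X : C) : C := FibrantObject.HoCat.resolutionObj X

/-- The trivial cofibration to the fibrant replacement. -/
abbrev fibRepHom (X : C) : X ⟶ fibRep X := FibrantObject.HoCat.iResolutionObj X

/-- The derived unit `Q A ⟶ U R F Q A`, where `Q` and `R` are the cofibrant and fibrant
replacements. -/
def derivedUnit (adj : F ⊣ U) (A : C) : cofRep A ⟶ U.obj (fibRep (F.obj (cofRep A))) :=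
  adj.unit.app (cofRep A) ≫ U.map (fibRepHom (F.obj (cofRep A)))

/-- The derived counit `F Q U R B ⟶ R B`. -/
def derivedCounit (adj : F ⊣ U) (B : D) : F.obj (cofRep (U.obj (fibRep B))) ⟶ fibRep B :=
  F.map (cofRepHom (U.obj (fibRep B))) ≫ adj.counit.app (fibRep B)

end Quillen

/-- A functor preserves coproducts (indexed by types of the universe `w`). -/
def PreservesCoproducts {T : Type u} [Category.{v} T] {T' : Type u'} [Category.{v'} T']
    (G : T ⥤ T') : Prop :=
  ∀ I : Type w, PreservesColimitsOfShape (Discrete I) G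

end StableModel

end

noncomputable section

namespace StableModel

/-! ### Morphisms, weak equivalences and coproducts in the homotopy category -/

section Basics

variable {C : Type u} [Category.{v} C] [ModelCategory C]

/-! The argument runs in the homotopy categories, where LF is left adjoint to RU
(`IsQuillenPair.derivedAdjunction`), and uses three properties of LF: it has a right adjoint, it
commutes with suspension, and it preserves cofiber sequences.

First claim. If RU preserves coproducts, then [LF k, ∐ A_i] = [k, RU ∐ A_i] = [k, ∐ RU A_i] = ⊕ [k,
RU A_i] = ⊕ [LF k, A_i], so LF k is compact. Conversely, consider the comparison map ∐ RU B_i ⟶ RU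
(∐ B_i). If X and LF X are both compact, the adjunction shows that [X, -] sends it to a bijection.
The class of such X contains the generators and is stable under suspension and desuspension. The
general principle `IsGeneratingSet.isIso_of_closed` then makes the comparison invertible: the
objects that see as bijections all the morphisms so seen by a given (de)suspension-stable class form
a localising subcategory, hence everything once that class contains generators, and Yoneda applies.

Second claim. The objects at which the derived unit is invertible form a localising subcategory
(`isLocalising_isIso_unit`): the five lemma treats cofibers, and coproducts pass through because RU
preserves them. Hence the unit is invertible everywhere and LF is fully faithful. It follows that
every object in the essential image of LF sees the counit as a bijection. This image is stable under
suspension and desuspension and contains the generators of D, because the counit is invertible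
there; the same principle makes the counit invertible everywhere. Since a morphism invertible in the
homotopy category is a weak equivalence, the derived equivalence gives the Quillen equivalence.

No triangulated structure is constructed. Exactness is expressed through weak kernels and weak
cokernels of cofiber sequences, with stability supplying the weak kernels. The five lemma also needs
subtraction, so the homotopy category is shown to be preadditive (`nonempty_preadditive`), by
composing unions of cones on a common base like edges of a groupoid. -/

lemma exists_cofibrant_fibrant_iso (X : Ho C) :
    ∃ (A : C) (_ : IsCofibrant A) (_ : IsFibrant A), Nonempty (X ≅ (toHo C).obj A) := by
  have := Localization.essSurj (toHo C) (weakEquivalences C)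
  let A := (toHo C).objPreimage X
  let Q := cofRep A
  have : IsIso ((toHo C).map (cofRepHom A)) := isIso_toHo_map _
  have : IsIso ((toHo C).map (fibRepHom Q)) := isIso_toHo_map _
  exact ⟨fibRep Q, isCofibrant_of_cofibration (fibRepHom Q), inferInstance,
    ⟨((toHo C).objObjPreimageIso X).symm ≪≫ (asIso ((toHo C).map (cofRepHom A))).symm ≪≫
      asIso ((toHo C).map (fibRepHom Q))⟩⟩

lemma exists_toHo_map_eq {A B : C} [IsCofibrant A] [IsFibrant B]
    (f : (toHo C).obj A ⟶ (toHo C).obj B) : ∃ g : A ⟶ B, (toHo C).map g = f :=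
  map_surjective_of_isLocalization (toHo C) A B f

/-- Homotopy extension: a morphism on the source of a cofibration which in the homotopy category
agrees with the restriction of `l` extends to a morphism with the same class as `l`. -/
lemma exists_extension_of_toHo_map_eq {A X B : C} [IsCofibrant A] [IsFibrant B] (i : A ⟶ X)
    [Cofibration i] (l : X ⟶ B) (f : A ⟶ B) (h : (toHo C).map (i ≫ l) = (toHo C).map f) :
    ∃ l' : X ⟶ B, i ≫ l' = f ∧ (toHo C).map l' = (toHo C).map l := by
  rw [← RightHomotopyRel.iff_map_eq (toHo C) A B] at h
  obtain ⟨P, _, ⟨h⟩⟩ := h.exists_good_pathObject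
  obtain ⟨l', h', e⟩ := h.homotopy_extension i l
  refine ⟨l', ?_, ?_⟩
  · rw [← h'.h₁, reassoc_of% e, h.h₁]
  · exact ((RightHomotopyRel.factorsThroughLocalization C h'.rightHomotopyRel).map_eq
      (toHo C)).symm

/-- Homotopy lifting along a fibration. -/
lemma exists_lift_of_toHo_map_eq {A X B : C} [IsCofibrant A] [IsFibrant X] [IsFibrant B]
    (p : X ⟶ B) [Fibration p] (l : A ⟶ X) (f : A ⟶ B)
    (h : (toHo C).map (l ≫ p) = (toHo C).map f) :
    ∃ l' : A ⟶ X, l' ≫ p = f ∧ (toHo C).map l' = (toHo C).map l := by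
  rw [← LeftHomotopyRel.iff_map_eq (toHo C) A B] at h
  obtain ⟨P, _, ⟨h⟩⟩ := h.exists_good_cylinder
  have sq : CommSq l P.i₀ p h.h := ⟨h.h₀.symm⟩
  refine ⟨P.i₁ ≫ sq.lift, by rw [Category.assoc, sq.fac_right, h.h₁], ?_⟩
  have h' : P.LeftHomotopy l (P.i₁ ≫ sq.lift) := { h := sq.lift, h₀ := sq.fac_left, h₁ := rfl }
  exact ((LeftHomotopyRel.factorsThroughLocalization C ⟨P, ⟨h'⟩⟩).map_eq (toHo C)).symm

lemma weakEquivalence_of_toHo_map_eq_id {Z : C} [IsCofibrant Z] [IsFibrant Z] (f : Z ⟶ Z)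
    (h : (toHo C).map f = 𝟙 _) : WeakEquivalence f := by
  rw [← (toHo C).map_id, ← RightHomotopyRel.iff_map_eq (toHo C) Z Z] at h
  obtain ⟨P, ⟨h⟩⟩ := h
  rw [h.weakEquivalence_iff]
  infer_instance

/-- After a trivial cofibration is split off, what remains is a fibration `p`. Its inverse in the
homotopy category can be rectified, by homotopy lifting, to a strict section `s`. Then `p` is a
retract of `p ≫ s`, which is homotopic to the identity. -/
lemma weakEquivalence_of_isIso_toHo_map_of_bifibrant {X Y : C} [IsCofibrant X] [IsFibrant X]
    [IsCofibrant Y] [IsFibrant Y] (f : X ⟶ Y) [IsIso ((toHo C).map f)] : WeakEquivalence f := by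
  let d := MorphismProperty.factorizationData (trivialCofibrations C) (fibrations C) f
  have : IsCofibrant d.Z := isCofibrant_of_cofibration d.i
  have : IsFibrant d.Z := isFibrant_of_fibration d.p
  have hi := isIso_toHo_map d.i
  have hp : IsIso ((toHo C).map d.p) := by
    have : IsIso ((toHo C).map d.i ≫ (toHo C).map d.p) := by
      rw [← Functor.map_comp, d.fac]; infer_instance
    exact IsIso.of_isIso_comp_left ((toHo C).map d.i) _
  obtain ⟨s₀, hs₀⟩ := exists_toHo_map_eq (inv ((toHo C).map d.p))
  obtain ⟨s, hs, hs'⟩ := exists_lift_of_toHo_map_eq d.p s₀ (𝟙 Y) (by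
    rw [Functor.map_comp, hs₀, IsIso.inv_hom_id, CategoryTheory.Functor.map_id])
  have hw : WeakEquivalence (d.p ≫ s) := weakEquivalence_of_toHo_map_eq_id _ (by
    rw [Functor.map_comp, hs', hs₀, IsIso.hom_inv_id])
  have hw' : WeakEquivalence d.p := by
    rw [weakEquivalence_iff] at hw ⊢
    refine MorphismProperty.of_retract (P := weakEquivalences C) (f := d.p) (g := d.p ≫ s) ?_ hw
    exact
      { i := Arrow.homMk (𝟙 _) s (by simp)
        r := Arrow.homMk (𝟙 _) d.p (by simp [hs])
        retract := by ext <;> simp [hs] }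
  rw [← d.fac]
  infer_instance

/-- The weak equivalences are the morphisms which become invertible in the homotopy category. -/
lemma weakEquivalence_of_isIso_toHo_map {X Y : C} (f : X ⟶ Y) [IsIso ((toHo C).map f)] :
    WeakEquivalence f := by
  wlog hX : IsCofibrant X ∧ IsCofibrant Y generalizing X Y
  · have _ := isIso_toHo_map (cofRepHom X)
    have _ := isIso_toHo_map (cofRepHom Y)
    have e := congrArg (toHo C).map (CofibrantObject.HoCat.resolutionMap_fac f)
    have _ : IsIso ((toHo C).map (CofibrantObject.HoCat.resolutionMap f)) := by
      rw [Functor.map_comp, Functor.map_comp] at e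
      rw [← IsIso.eq_comp_inv] at e
      rw [e]
      infer_instance
    rw [← CofibrantObject.HoCat.weakEquivalence_resolutionMap_iff]
    exact this (CofibrantObject.HoCat.resolutionMap f) ⟨inferInstance, inferInstance⟩
  obtain ⟨_, _⟩ := hX
  have := isIso_toHo_map (fibRepHom X)
  have := isIso_toHo_map (fibRepHom Y)
  have : IsCofibrant (fibRep X) := isCofibrant_of_cofibration (fibRepHom X)
  have : IsCofibrant (fibRep Y) := isCofibrant_of_cofibration (fibRepHom Y)
  have e := congrArg (toHo C).map (FibrantObject.HoCat.resolutionMap_fac f)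
  have : IsIso ((toHo C).map (FibrantObject.HoCat.resolutionMap f)) := by
    rw [Functor.map_comp, Functor.map_comp] at e
    rw [← IsIso.eq_inv_comp] at e
    rw [e]
    infer_instance
  rw [← FibrantObject.HoCat.weakEquivalence_resolutionMap_iff]
  exact weakEquivalence_of_isIso_toHo_map_of_bifibrant _

lemma isIso_toHo_map_iff {X Y : C} (f : X ⟶ Y) :
    IsIso ((toHo C).map f) ↔ WeakEquivalence f :=
  ⟨fun _ => weakEquivalence_of_isIso_toHo_map f, fun _ => isIso_toHo_map f⟩

lemma isCofibrant_of_isZero {Z : C} (hZ : IsZero Z) : IsCofibrant Z := by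
  have : IsIso (initial.to Z) := ⟨hZ.to_ _, Subsingleton.elim _ _, hZ.eq_of_src _ _⟩
  infer_instance

lemma isFibrant_of_isZero {Z : C} (hZ : IsZero Z) : IsFibrant Z := by
  have : IsIso (terminal.from Z) := ⟨hZ.from_ _, hZ.eq_of_src _ _, Subsingleton.elim _ _⟩
  infer_instance

lemma isZero_toHo_obj {Z : C} (hZ : IsZero Z) : IsZero ((toHo C).obj Z) := by
  have := isCofibrant_of_isZero hZ
  have := isFibrant_of_isZero hZ
  constructor
  · intro Y
    obtain ⟨A, _, _, ⟨e⟩⟩ := exists_cofibrant_fibrant_iso Y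
    refine ⟨⟨⟨(toHo C).map (hZ.to_ A) ≫ e.inv⟩, fun f => ?_⟩⟩
    obtain ⟨g, hg⟩ := exists_toHo_map_eq (f ≫ e.hom)
    change f = _ ≫ e.inv
    rw [Iso.eq_comp_inv, ← hg, hZ.eq_of_src g (hZ.to_ A)]
  · intro Y
    obtain ⟨A, _, _, ⟨e⟩⟩ := exists_cofibrant_fibrant_iso Y
    refine ⟨⟨⟨e.hom ≫ (toHo C).map (hZ.from_ A)⟩, fun f => ?_⟩⟩
    obtain ⟨g, hg⟩ := exists_toHo_map_eq (e.inv ≫ f)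
    change f = e.hom ≫ _
    rw [← Iso.inv_comp_eq, ← hg, hZ.eq_of_tgt g (hZ.from_ A)]

instance [HasZeroObject C] : HasZeroObject (Ho C) :=
  ⟨(toHo C).obj _, isZero_toHo_obj (isZero_zero C)⟩

lemma isCofibrant_cofan_pt {I : Type w} {X : I → C} (hX : ∀ i, IsCofibrant (X i)) (c : Cofan X)
    (hc : IsColimit c) : IsCofibrant c.pt := by
  rw [isCofibrant_iff, cofibration_iff, ← trivialFibrations_llp]
  intro A B p hp
  obtain ⟨hp, hp'⟩ := (mem_trivialFibrations_iff _).1 hp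
  refine ⟨fun {f g} sq => ?_⟩
  have sq' (i : I) : CommSq (initial.to A) (initial.to (X i)) p (c.inj i ≫ g) := ⟨by simp⟩
  refine ⟨⟨⟨Cofan.IsColimit.desc hc (fun i => (sq' i).lift), Subsingleton.elim _ _, ?_⟩⟩⟩
  refine Cofan.IsColimit.hom_ext hc _ _ (fun i => ?_)
  rw [Cofan.IsColimit.fac_assoc, (sq' i).fac_right]

/-- The localization functor preserves coproducts of cofibrant objects. -/
lemma nonempty_isColimit_toHo_cofan {I : Type w} {X : I → C} (hX : ∀ i, IsCofibrant (X i))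
    (c : Cofan X) (hc : IsColimit c) :
    Nonempty (IsColimit (Cofan.mk ((toHo C).obj c.pt) (fun i => (toHo C).map (c.inj i)))) := by
  have := isCofibrant_cofan_pt hX c hc
  have key : ∀ (T : C) [IsFibrant T] (f : ∀ i, (toHo C).obj (X i) ⟶ (toHo C).obj T),
      ∃! g : (toHo C).obj c.pt ⟶ (toHo C).obj T, ∀ i, (toHo C).map (c.inj i) ≫ g = f i := by
    intro T _ f
    choose f' hf' using fun i => exists_toHo_map_eq (f i)
    refine ⟨(toHo C).map (Cofan.IsColimit.desc hc f'), fun i => ?_, fun g hg => ?_⟩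
    · rw [← Functor.map_comp, Cofan.IsColimit.fac, hf']
    · obtain ⟨g, rfl⟩ := exists_toHo_map_eq g
      -- A path object of the target does not depend on `i`. All the homotopies can therefore be
      -- taken on the same `P` and assembled by the universal property of the coproduct, however
      -- large `I` is.
      obtain ⟨P, _⟩ := PathObject.exists_very_good T
      have H (i : I) : P.RightHomotopy (c.inj i ≫ g) (f' i) := by
        refine RightHomotopyRel.rightHomotopy ?_ P
        rw [RightHomotopyRel.iff_map_eq (toHo C), Functor.map_comp, hg, hf']
      rw [← RightHomotopyRel.iff_map_eq (toHo C)]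
      refine ⟨P, ⟨{ h := Cofan.IsColimit.desc hc (fun i => (H i).h), h₀ := ?_, h₁ := ?_ }⟩⟩
      · refine Cofan.IsColimit.hom_ext hc _ _ (fun i => ?_)
        rw [Cofan.IsColimit.fac_assoc, (H i).h₀]
      · refine Cofan.IsColimit.hom_ext hc _ _ (fun i => ?_)
        rw [Cofan.IsColimit.fac_assoc, (H i).h₁, Cofan.IsColimit.fac]
  have key' : ∀ (T : Ho C) (f : ∀ i, (toHo C).obj (X i) ⟶ T),
      ∃! g : (toHo C).obj c.pt ⟶ T, ∀ i, (toHo C).map (c.inj i) ≫ g = f i := by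
    intro T f
    obtain ⟨A, _, _, ⟨e⟩⟩ := exists_cofibrant_fibrant_iso T
    obtain ⟨g, hg, hg'⟩ := key A (fun i => f i ≫ e.hom)
    refine ⟨g ≫ e.inv, fun i => by simp [reassoc_of% hg i], fun g₂ h₂ => ?_⟩
    rw [Iso.eq_comp_inv]
    exact hg' _ (fun i => by simp [← h₂ i])
  exact ⟨Cofan.IsColimit.mk _ (fun s => (key' s.pt s.inj).choose)
    (fun s i => (key' s.pt s.inj).choose_spec.1 i)
    (fun s m hm => (key' s.pt s.inj).choose_spec.2 m hm)⟩

instance [HasCoproducts.{w} C] : HasCoproducts.{w} (Ho C) := by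
  intro I
  have (X : I → Ho C) : HasColimit (Discrete.functor X) := by
    choose A hA _ e using fun i => exists_cofibrant_fibrant_iso (X i)
    obtain ⟨h⟩ := nonempty_isColimit_toHo_cofan hA _ (coproductIsCoproduct A)
    have : HasColimit (Discrete.functor fun i => (toHo C).obj (A i)) := ⟨_, h⟩
    exact hasColimit_of_iso (F := Discrete.functor fun i => (toHo C).obj (A i))
      (Discrete.natIso (fun i => (e i.as).some))
  exact ⟨fun F => hasColimit_of_iso (Discrete.natIsoFunctor (F := F))⟩

end Basics


/-! ### Cones, collapsing contractible subobjects, and rotation of cofiber sequences -/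

section CofiberSequences

variable {C : Type u} [Category.{v} C] [ModelCategory C] [HasZeroObject C] [HasZeroMorphisms C]

open ZeroObject

lemma weakEquivalence_initial_to {V : C} (hV : WeakEquivalence (0 : V ⟶ (0 : C))) :
    WeakEquivalence (initial.to V) := by
  have h₀ : IsZero (⊥_ C) := (isZero_zero C).of_iso HasZeroObject.zeroIsoInitial.symm
  have : IsIso (0 : (⊥_ C) ⟶ (0 : C)) := ⟨0, h₀.eq_of_src _ _, (isZero_zero C).eq_of_src _ _⟩
  exact weakEquivalence_of_postcomp_of_fac (f := initial.to V) (g := (0 : V ⟶ (0 : C)))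
    (fg := 0) (by simp)

/-- Collapsing a contractible cofibrant subobject is a weak equivalence. -/
lemma weakEquivalence_cokernel_π {V W : C} (j : V ⟶ W) [IsCofibrant V] [Cofibration j]
    (hV : WeakEquivalence (0 : V ⟶ (0 : C))) : WeakEquivalence (cokernel.π j) := by
  have : IsCofibrant W := isCofibrant_of_cofibration j
  obtain ⟨P, _⟩ := Cylinder.exists_very_good W
  -- `W` is embedded at one end of its cylinder and `V` at the other. As `V` is contractible, this
  -- is a trivial cofibration; pushing it out along `(𝟙, 0)` shows that `W` is equivalent to the
  -- cylinder with `V` collapsed at the far end. That object retracts onto `W / V`, so no properness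
  -- assumption is needed.
  let m : W ⨿ V ⟶ P.I := coprod.map (𝟙 W) j ≫ P.i
  have hm₀ : coprod.inl ≫ m = P.i₀ := by simp [m]
  have hm₁ : coprod.inr ≫ m = j ≫ P.i₁ := by simp [m]
  have hV' := weakEquivalence_initial_to hV
  have hinl : WeakEquivalence (coprod.inl : W ⟶ W ⨿ V) := by
    rw [weakEquivalence_iff]
    exact (MorphismProperty.of_isPushout (P := trivialCofibrations C)
      ((IsPushout.of_isColimit_binaryCofan_of_isInitial
        (colimit.isColimit (pair W V)) initialIsInitial).flip)
      (mem_trivialCofibrations (initial.to V))).2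
  have : WeakEquivalence m := weakEquivalence_of_precomp_of_fac hm₀
  have : Cofibration m := by dsimp only [m]; infer_instance
  let k : V ⟶ P.I := j ≫ P.i₁
  have sq : IsPushout m (coprod.desc (𝟙 W) 0) (cokernel.π k) (P.i₀ ≫ cokernel.π k) := by
    refine ⟨⟨?_⟩, ⟨PushoutCocone.IsColimit.mk _ (fun s => cokernel.desc _ s.inl ?_) ?_ ?_ ?_⟩⟩
    · apply coprod.hom_ext
      · rw [reassoc_of% hm₀, coprod.inl_desc_assoc, Category.id_comp]
      · rw [reassoc_of% hm₁, coprod.inr_desc_assoc, zero_comp, ← Category.assoc,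
          cokernel.condition]
    · have := coprod.inr ≫= s.condition
      rw [reassoc_of% hm₁, coprod.inr_desc_assoc, zero_comp] at this
      simpa [k] using this
    · intro s; simp
    · intro s
      have := coprod.inl ≫= s.condition
      rw [reassoc_of% hm₀, coprod.inl_desc_assoc, Category.id_comp] at this
      simpa using this
    · intro s m h₁ h₂
      rw [← cancel_epi (cokernel.π k)]
      simpa using h₁
  have h₀ : WeakEquivalence (P.i₀ ≫ cokernel.π k) := by
    rw [weakEquivalence_iff]
    exact (MorphismProperty.of_isPushout (P := trivialCofibrations C) sq.flip
      (mem_trivialCofibrations m)).2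
  let J : cokernel j ⟶ cokernel k := cokernel.map j k (𝟙 V) P.i₁ (by simp [k])
  let p : cokernel k ⟶ cokernel j := cokernel.map k j (𝟙 V) P.π (by simp [k])
  have hJ : WeakEquivalence J := weakEquivalence_cokernel_map j P.i₁ k rfl
  have hJp : J ≫ p = 𝟙 _ := by
    rw [← cancel_epi (cokernel.π j)]
    simp [J, p]
  have hp : WeakEquivalence p := weakEquivalence_of_precomp_of_fac hJp
  have e : cokernel.π j = (P.i₀ ≫ cokernel.π k) ≫ p := by simp [p]
  rw [e]
  infer_instance

/-- The suspension of the class of a cofibrant object is computed by its cone. -/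
def suspensionIso (A : C) [IsCofibrant A] :
    (suspension C).obj ((toHo C).obj A) ≅ (toHo C).obj (suspObj A) :=
  (Localization.fac (suspCof C) (suspCof_inverts C) (CofibrantObject.ι ⋙ toHo C)).app
    (CofibrantObject.mk A)

lemma suspensionIso_naturality {A B : C} [IsCofibrant A] [IsCofibrant B] (f : A ⟶ B) :
    (suspension C).map ((toHo C).map f) ≫ (suspensionIso B).hom =
      (suspensionIso A).hom ≫ (toHo C).map (suspMap f) :=
  (Localization.fac (suspCof C) (suspCof_inverts C)
    (CofibrantObject.ι ⋙ toHo C)).hom.naturality (CofibrantObject.homMk f)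

lemma weakEquivalence_zero_cone (A : C) : WeakEquivalence (0 : cone A ⟶ (0 : C)) :=
  (isContractibleFibrant_cone A).2

instance (A : C) [IsCofibrant A] : IsCofibrant (cone A) := isCofibrant_of_cofibration (coneι A)

/-- The mapping cone of a morphism. -/
abbrev mappingCone {A B : C} (i : A ⟶ B) : C := pushout i (coneι A)

/-- The comparison from the mapping cone to the cokernel. -/
def mappingConeToCokernel {A B : C} (i : A ⟶ B) : mappingCone i ⟶ cokernel i :=
  pushout.desc (cokernel.π i) 0 (by simp)

lemma inl_mappingConeToCokernel {A B : C} (i : A ⟶ B) :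
    pushout.inl _ _ ≫ mappingConeToCokernel i = cokernel.π i :=
  pushout.inl_desc _ _ _

lemma inr_mappingConeToCokernel {A B : C} (i : A ⟶ B) :
    pushout.inr _ _ ≫ mappingConeToCokernel i = 0 :=
  pushout.inr_desc _ _ _

/-- Up to an isomorphism of targets, the comparison is the quotient of the mapping cone by the
contractible cone on `A`. -/
lemma weakEquivalence_mappingConeToCokernel {A B : C} (i : A ⟶ B) [IsCofibrant A]
    [Cofibration i] : WeakEquivalence (mappingConeToCokernel i) := by
  let φ : cokernel i ⟶ cokernel (pushout.inr i (coneι A)) :=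
    cokernel.map _ _ (coneι A) (pushout.inl _ _) pushout.condition
  have : IsIso φ := isIso_cokernel_map_of_isPushout (IsPushout.of_hasPushout i (coneι A))
  have := weakEquivalence_cokernel_π (pushout.inr i (coneι A)) (weakEquivalence_zero_cone A)
  refine weakEquivalence_of_postcomp_of_fac (g := φ) (fg := cokernel.π _) ?_
  apply pushout.hom_ext
  · rw [reassoc_of% inl_mappingConeToCokernel, cokernel.π_desc]
  · rw [reassoc_of% inr_mappingConeToCokernel, zero_comp, cokernel.condition]

/-- The quotient of the mapping cone of `A ⟶ B` by `B` is the suspension of `A`. -/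
def suspObjToCokernelInl {A B : C} (i : A ⟶ B) :
    suspObj A ⟶ cokernel (pushout.inl i (coneι A)) :=
  cokernel.map _ _ i (pushout.inr _ _) pushout.condition.symm

instance {A B : C} (i : A ⟶ B) : IsIso (suspObjToCokernelInl i) :=
  isIso_cokernel_map_of_isPushout (IsPushout.of_hasPushout i (coneι A)).flip

/-- Cofiber sequences can be rotated. -/
lemma IsCofiberSequence.rotate {X Y Z : Ho C} {f : X ⟶ Y} {g : Y ⟶ Z}
    (h : IsCofiberSequence f g) :
    ∃ δ : Z ⟶ (suspension C).obj X, IsCofiberSequence g δ := by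
  obtain ⟨A, B, i, _, _, a, b, c, -, hg⟩ := h
  have : IsCofibrant B := isCofibrant_of_cofibration i
  have := weakEquivalence_mappingConeToCokernel i
  have := isIso_toHo_map (mappingConeToCokernel i)
  let c' : Z ≅ (toHo C).obj (mappingCone i) :=
    c ≪≫ (asIso ((toHo C).map (mappingConeToCokernel i))).symm
  let d : (suspension C).obj X ≅ (toHo C).obj (cokernel (pushout.inl i (coneι A))) :=
    (suspension C).mapIso a ≪≫ suspensionIso A ≪≫ (toHo C).mapIso (asIso (suspObjToCokernelInl i))
  -- The boundary morphism is the collapse of the mapping cone onto its quotient by `B`, which is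
  -- the suspension of `A`. No sign has to be fixed, as only exactness is used later.
  refine ⟨c'.hom ≫ (toHo C).map (cokernel.π _) ≫ d.inv, B, mappingCone i, pushout.inl _ _,
    inferInstance, inferInstance, b, c', d, ?_, by simp⟩
  simp only [c', Iso.trans_hom, Iso.symm_hom, asIso_inv, reassoc_of% hg,
    ← inl_mappingConeToCokernel i, Functor.map_comp, Category.assoc, IsIso.hom_inv_id,
    Category.comp_id]

-- A fibrant middle term lets morphisms into it from a cofibrant object be represented in the model
-- category. Fibrant replacement of `B` leaves the quotient unchanged up to weak equivalence, since
-- trivial cofibrations are stable under pushout.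
omit [HasZeroObject C] in
lemma IsCofiberSequence.exists_fibrant {X Y Z : Ho C} {f : X ⟶ Y} {g : Y ⟶ Z}
    (h : IsCofiberSequence f g) :
    ∃ (A B : C) (i : A ⟶ B) (_ : IsCofibrant A) (_ : IsFibrant B) (_ : Cofibration i)
      (a : X ≅ (toHo C).obj A) (b : Y ≅ (toHo C).obj B) (c : Z ≅ (toHo C).obj (cokernel i)),
      f ≫ b.hom = a.hom ≫ (toHo C).map i ∧
        g ≫ c.hom = b.hom ≫ (toHo C).map (cokernel.π i) := by
  obtain ⟨A, B, i, _, _, a, b, c, hf, hg⟩ := h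
  let k := i ≫ fibRepHom B
  have := isIso_toHo_map (fibRepHom B)
  let J : cokernel i ⟶ cokernel k := cokernel.map i k (𝟙 A) (fibRepHom B) (by simp [k])
  have : WeakEquivalence J := weakEquivalence_cokernel_map i (fibRepHom B) k rfl
  have := isIso_toHo_map J
  refine ⟨A, fibRep B, k, inferInstance, inferInstance, inferInstance, a,
    b ≪≫ asIso ((toHo C).map (fibRepHom B)),
    c ≪≫ asIso ((toHo C).map J), ?_, ?_⟩
  · simp [k, reassoc_of% hf]
  · simp only [Iso.trans_hom, asIso_hom, reassoc_of% hg, ← Functor.map_comp, Category.assoc,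
      J, cokernel.π_desc, k]

end CofiberSequences

/-! ### Weak kernels and weak cokernels -/

section WeakKernels

variable {T : Type u} [Category.{v} T] [HasZeroMorphisms T]

/-- `g` is a weak cokernel of `f`. -/
structure IsWeakCokernel {X Y Z : T} (f : X ⟶ Y) (g : Y ⟶ Z) : Prop where
  zero : f ≫ g = 0
  exists_desc : ∀ {W : T} (u : Y ⟶ W), f ≫ u = 0 → ∃ v : Z ⟶ W, g ≫ v = u

/-- `f` is a weak kernel of `g`. -/
structure IsWeakKernel {X Y Z : T} (f : X ⟶ Y) (g : Y ⟶ Z) : Prop where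
  zero : f ≫ g = 0
  exists_lift : ∀ {W : T} (u : W ⟶ Y), u ≫ g = 0 → ∃ v : W ⟶ X, v ≫ f = u

end WeakKernels

/-! ### Exactness of cofiber sequences on both sides -/

section Exactness

variable {C : Type u} [Category.{v} C] [ModelCategory C] [HasZeroObject C] [HasZeroMorphisms C]
  [HasZeroMorphisms (Ho C)]

open ZeroObject

lemma toHo_map_zero (A B : C) : (toHo C).map (0 : A ⟶ B) = 0 := by
  have e : (0 : A ⟶ B) = (0 : A ⟶ (0 : C)) ≫ 0 := by simp
  rw [e, Functor.map_comp]
  exact (isZero_toHo_obj (isZero_zero C)).eq_zero_of_tgt _ =≫ _ |>.trans zero_comp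

lemma IsCofiberSequence.zero {X Y Z : Ho C} {f : X ⟶ Y} {g : Y ⟶ Z}
    (h : IsCofiberSequence f g) : f ≫ g = 0 := by
  obtain ⟨A, B, i, _, _, a, b, c, hf, hg⟩ := h
  rw [← cancel_mono c.hom, Category.assoc, hg, reassoc_of% hf, ← Functor.map_comp,
    cokernel.condition, toHo_map_zero, comp_zero, zero_comp]

/-- A morphism whose restriction to `A` is null can be deformed, by homotopy extension, to one
vanishing strictly on `A`; that one factors through the quotient. Stability plays no role on this
side. -/
lemma IsCofiberSequence.isWeakCokernel {X Y Z : Ho C} {f : X ⟶ Y} {g : Y ⟶ Z}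
    (h : IsCofiberSequence f g) : IsWeakCokernel f g where
  zero := h.zero
  exists_desc {W} u hu := by
    obtain ⟨A, B, i, _, _, a, b, c, hf, hg⟩ := h
    obtain ⟨T, _, _, ⟨e⟩⟩ := exists_cofibrant_fibrant_iso W
    have : IsCofibrant B := isCofibrant_of_cofibration i
    obtain ⟨t, ht⟩ := exists_toHo_map_eq (b.inv ≫ u ≫ e.hom)
    obtain ⟨t', ht', e'⟩ := exists_extension_of_toHo_map_eq i t 0 (by
      rw [toHo_map_zero, Functor.map_comp, ht, ← cancel_epi a.hom, ← reassoc_of% hf,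
        Iso.hom_inv_id_assoc, reassoc_of% hu, zero_comp, comp_zero])
    refine ⟨c.hom ≫ (toHo C).map (cokernel.desc i t' ht') ≫ e.inv, ?_⟩
    rw [reassoc_of% hg, ← Functor.map_comp_assoc, cokernel.π_desc, e', ht]
    simp

/-- In a stable model category a morphism which vanishes in the cofiber lifts. -/
lemma exists_lift_of_comp_cokernel_π_eq_zero [IsStable C] {A B T : C} (i : A ⟶ B)
    [IsCofibrant A] [Cofibration i] [IsCofibrant T] (u : T ⟶ B)
    (hu : (toHo C).map (u ≫ cokernel.π i) = 0) :
    ∃ v : (toHo C).obj T ⟶ (toHo C).obj A, v ≫ (toHo C).map i = (toHo C).map u := by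
  have : IsCofibrant B := isCofibrant_of_cofibration i
  have := weakEquivalence_mappingConeToCokernel i
  have := isIso_toHo_map (mappingConeToCokernel i)
  let w := fibRepHom (mappingCone i)
  let k : B ⟶ fibRep (mappingCone i) := pushout.inl _ _ ≫ w
  -- As `u` becomes null in the mapping cone of `i`, it extends over the cone on `T`. Dividing the
  -- extension by `B` gives a morphism from the suspension of `T` to that of `A`, whose composite
  -- with the suspension of `i` is the suspension of `u`. Stability then desuspends both the
  -- morphism and the identity.
  obtain ⟨H, hH, -⟩ := exists_extension_of_toHo_map_eq (coneι T) 0 (u ≫ k) (by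
    rw [comp_zero, toHo_map_zero]
    symm
    have : (toHo C).map (u ≫ pushout.inl i (coneι A)) = 0 := by
      rw [← cancel_mono ((toHo C).map (mappingConeToCokernel i)), ← Functor.map_comp,
        Category.assoc, inl_mappingConeToCokernel, hu, zero_comp]
    rw [← Category.assoc, Functor.map_comp, this, zero_comp])
  -- Through `e`, both `suspMap u` and `suspMap i` are induced by extensions to cones that factor
  -- through the same quotient `cokernel k`, so they can be compared there.
  obtain ⟨e, he⟩ := exists_extension k (coneι B) (isContractibleFibrant_cone B)
  let v₀ : suspObj T ⟶ cokernel k := cokernel.map _ _ u H hH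
  let κ : cokernel k ⟶ suspObj B := cokernel.map _ _ (𝟙 B) e (by simp [he])
  let ψ : cokernel (pushout.inl i (coneι A)) ⟶ cokernel k := cokernel.map _ _ (𝟙 B) w (by simp [k])
  let χ : suspObj A ⟶ cokernel k := suspObjToCokernelInl i ≫ ψ
  have : WeakEquivalence ψ := weakEquivalence_cokernel_map _ w k rfl
  have : IsIso ((toHo C).map χ) := isIso_toHo_map _
  have h₁ : (toHo C).map (suspMap u) = (toHo C).map v₀ ≫ (toHo C).map κ := by
    rw [toHo_map_suspMap u (H ≫ e) (by rw [reassoc_of% hH, he]), ← Functor.map_comp]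
    congr 1
    rw [← cancel_epi (cokernel.π (coneι T))]
    simp [v₀, κ]
  have hi : coneι A ≫ pushout.inr i (coneι A) ≫ w ≫ e = i ≫ coneι B := by
    rw [← pushout.condition_assoc, ← he]; simp [k]
  have h₂ : (toHo C).map (suspMap i) = (toHo C).map χ ≫ (toHo C).map κ := by
    rw [toHo_map_suspMap i (pushout.inr _ _ ≫ w ≫ e) hi, ← Functor.map_comp]
    congr 1
    rw [← cancel_epi (cokernel.π (coneι A))]
    simp [χ, ψ, κ, suspObjToCokernelInl]
  have := IsStable.isEquivalence_suspension (C := C)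
  obtain ⟨v, hv⟩ := (suspension C).map_surjective
    ((suspensionIso T).hom ≫ (toHo C).map v₀ ≫ inv ((toHo C).map χ) ≫ (suspensionIso A).inv)
  refine ⟨v, (suspension C).map_injective ?_⟩
  rw [← cancel_mono (suspensionIso B).hom, Functor.map_comp, hv, Category.assoc,
    suspensionIso_naturality, suspensionIso_naturality, h₁, h₂]
  simp

lemma IsCofiberSequence.isWeakKernel [IsStable C] {X Y Z : Ho C} {f : X ⟶ Y} {g : Y ⟶ Z}
    (h : IsCofiberSequence f g) : IsWeakKernel f g where
  zero := h.zero
  exists_lift {W} u hu := by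
    obtain ⟨A, B, i, _, _, _, a, b, c, hf, hg⟩ := h.exists_fibrant
    obtain ⟨T, _, _, ⟨e⟩⟩ := exists_cofibrant_fibrant_iso W
    obtain ⟨t, ht⟩ := exists_toHo_map_eq (e.inv ≫ u ≫ b.hom)
    obtain ⟨v, hv⟩ := exists_lift_of_comp_cokernel_π_eq_zero i t (by
      rw [Functor.map_comp, ht]
      simp only [Category.assoc]
      rw [← hg, reassoc_of% hu, zero_comp, comp_zero])
    refine ⟨e.hom ≫ v ≫ a.inv, ?_⟩
    rw [← cancel_mono b.hom]
    simp only [Category.assoc, hf, Iso.inv_hom_id_assoc, hv, ht, Iso.hom_inv_id_assoc]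

end Exactness


/-! ### Gluing along contractible objects, and unions of cones -/

section Gluing

variable {C : Type u} [Category.{v} C] [ModelCategory C]

/-- A binary coproduct of cofibrant objects is a coproduct in the homotopy category. -/
lemma existsUnique_toHo_desc {M M' N : C} [IsCofibrant M] [IsCofibrant M'] [IsCofibrant N]
    {β : M ⟶ N} {β' : M' ⟶ N}
    (hβ : ∀ {T : C} (f : M ⟶ T) (g : M' ⟶ T), ∃! h : N ⟶ T, β ≫ h = f ∧ β' ≫ h = g)
    {T : Ho C} (x : (toHo C).obj M ⟶ T) (y : (toHo C).obj M' ⟶ T) :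
    ∃! z : (toHo C).obj N ⟶ T, (toHo C).map β ≫ z = x ∧ (toHo C).map β' ≫ z = y := by
  obtain ⟨A, _, _, ⟨e⟩⟩ := exists_cofibrant_fibrant_iso T
  obtain ⟨f, hf⟩ := exists_toHo_map_eq (x ≫ e.hom)
  obtain ⟨g, hg⟩ := exists_toHo_map_eq (y ≫ e.hom)
  obtain ⟨h, ⟨h₁, h₂⟩, -⟩ := hβ f g
  refine ⟨(toHo C).map h ≫ e.inv, ⟨?_, ?_⟩, ?_⟩
  · rw [← Functor.map_comp_assoc, h₁, hf, Category.assoc, e.hom_inv_id, Category.comp_id]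
  · rw [← Functor.map_comp_assoc, h₂, hg, Category.assoc, e.hom_inv_id, Category.comp_id]
  · rintro z ⟨h₃, h₄⟩
    obtain ⟨t, ht⟩ := exists_toHo_map_eq (z ≫ e.hom)
    obtain ⟨P, _⟩ := PathObject.exists_very_good A
    have H : P.RightHomotopy (β ≫ t) (β ≫ h) := by
      refine RightHomotopyRel.rightHomotopy ?_ P
      rw [RightHomotopyRel.iff_map_eq (toHo C), Functor.map_comp, ht, h₁, hf, reassoc_of% h₃]
    have H' : P.RightHomotopy (β' ≫ t) (β' ≫ h) := by
      refine RightHomotopyRel.rightHomotopy ?_ P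
      rw [RightHomotopyRel.iff_map_eq (toHo C), Functor.map_comp, ht, h₂, hg, reassoc_of% h₄]
    -- Both homotopies live on the same path object, so the universal property in `C` glues them.
    obtain ⟨K, ⟨hK, hK'⟩, -⟩ := hβ H.h H'.h
    rw [Iso.eq_comp_inv, ← ht, ← RightHomotopyRel.iff_map_eq (toHo C)]
    refine ⟨P, ⟨{ h := K, h₀ := ?_, h₁ := ?_ }⟩⟩
    · exact (hβ _ _).unique ⟨by rw [reassoc_of% hK, H.h₀], by rw [reassoc_of% hK', H'.h₀]⟩
        ⟨rfl, rfl⟩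
    · exact (hβ _ _).unique ⟨by rw [reassoc_of% hK, H.h₁], by rw [reassoc_of% hK', H'.h₁]⟩
        ⟨rfl, rfl⟩

variable [HasZeroObject C] [HasZeroMorphisms C]

open ZeroObject

lemma isCofibrant_cokernel {V W : C} (i : V ⟶ W) [Cofibration i] :
    IsCofibrant (cokernel i) := by
  have : Cofibration (0 : (0 : C) ⟶ cokernel i) := by
    rw [cofibration_iff]
    have h : IsPushout (0 : V ⟶ (0 : C)) i 0 (cokernel.π i) := by
      refine ⟨⟨by simp⟩, ⟨PushoutCocone.IsColimit.mk _
        (fun s => cokernel.desc _ s.inr (by rw [← s.condition, zero_comp])) ?_ ?_ ?_⟩⟩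
      · intro s; exact (isZero_zero C).eq_of_src _ _
      · intro s; simp
      · intro s m h₁ h₂
        rw [← cancel_epi (cokernel.π i)]
        simpa using h₂
    exact MorphismProperty.of_isPushout h (mem_cofibrations i)
  have := isCofibrant_of_isZero (isZero_zero C)
  exact isCofibrant_of_cofibration (0 : (0 : C) ⟶ cokernel i)

/-- Gluing along a contractible object is a coproduct in the homotopy category. -/
lemma existsUnique_of_isPushout_of_contractible {V B B' E : C} {j : V ⟶ B} {j' : V ⟶ B'}
    {b : B ⟶ E} {b' : B' ⟶ E} (sq : IsPushout j j' b b') [IsCofibrant V] [Cofibration j]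
    [Cofibration j'] (hV : WeakEquivalence (0 : V ⟶ (0 : C))) {T : Ho C}
    (x : (toHo C).obj B ⟶ T) (y : (toHo C).obj B' ⟶ T) :
    ∃! z : (toHo C).obj E ⟶ T, (toHo C).map b ≫ z = x ∧ (toHo C).map b' ≫ z = y := by
  have hb : Cofibration b := by
    rw [cofibration_iff]
    exact MorphismProperty.of_isPushout sq (mem_cofibrations j')
  let k : V ⟶ E := j ≫ b
  have : Cofibration k := by dsimp only [k]; infer_instance
  -- Collapsing `V` is a weak equivalence on each of the three objects, and it turns the pushout
  -- into a coproduct of cofibrant quotients.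
  let β : cokernel j ⟶ cokernel k := cokernel.map j k (𝟙 V) b (by simp [k])
  let β' : cokernel j' ⟶ cokernel k := cokernel.map j' k (𝟙 V) b' (by simp [k, sq.w])
  have hβ {T : C} (f : cokernel j ⟶ T) (g : cokernel j' ⟶ T) :
      ∃! h, β ≫ h = f ∧ β' ≫ h = g := by
    refine ⟨cokernel.desc _ (sq.desc (cokernel.π j ≫ f) (cokernel.π j' ≫ g) (by
      rw [cokernel.condition_assoc, cokernel.condition_assoc, zero_comp, zero_comp]))
      (by simp [k]), ⟨?_, ?_⟩, ?_⟩
    · rw [← cancel_epi (cokernel.π j)]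
      simp [β]
    · rw [← cancel_epi (cokernel.π j')]
      simp [β']
    · rintro m ⟨rfl, rfl⟩
      rw [← cancel_epi (cokernel.π k), cokernel.π_desc]
      apply sq.hom_ext
      · simp [β]
      · simp [β']
  have := isCofibrant_cokernel j
  have := isCofibrant_cokernel j'
  have := isCofibrant_cokernel k
  have := weakEquivalence_cokernel_π j hV
  have := weakEquivalence_cokernel_π j' hV
  have := weakEquivalence_cokernel_π k hV
  have i₁ := isIso_toHo_map (cokernel.π j)
  have i₂ := isIso_toHo_map (cokernel.π j')
  have i₃ := isIso_toHo_map (cokernel.π k)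
  have e₁ : (toHo C).map b ≫ (toHo C).map (cokernel.π k) =
      (toHo C).map (cokernel.π j) ≫ (toHo C).map β := by
    simp [← Functor.map_comp, β]
  have e₂ : (toHo C).map b' ≫ (toHo C).map (cokernel.π k) =
      (toHo C).map (cokernel.π j') ≫ (toHo C).map β' := by
    simp [← Functor.map_comp, β']
  obtain ⟨d, ⟨d₁, d₂⟩, d₃⟩ := existsUnique_toHo_desc hβ
    (inv ((toHo C).map (cokernel.π j)) ≫ x) (inv ((toHo C).map (cokernel.π j')) ≫ y)
  refine ⟨(toHo C).map (cokernel.π k) ≫ d, ⟨?_, ?_⟩, ?_⟩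
  · rw [reassoc_of% e₁, d₁, IsIso.hom_inv_id_assoc]
  · rw [reassoc_of% e₂, d₂, IsIso.hom_inv_id_assoc]
  · rintro z ⟨h₁, h₂⟩
    rw [← IsIso.inv_comp_eq]
    refine d₃ _ ⟨?_, ?_⟩
    · rw [IsIso.eq_inv_comp, ← reassoc_of% e₁, IsIso.hom_inv_id_assoc, h₁]
    · rw [IsIso.eq_inv_comp, ← reassoc_of% e₂, IsIso.hom_inv_id_assoc, h₂]

variable (S : C) {n : ℕ}

variable (n) in
/-- The union of `n` copies of the cone on `S` along their common base. -/
def coneGlue : C := widePushout S (fun _ : Fin n => cone S) (fun _ => coneι S)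

/-- The inclusion of a cone. -/
def glueι (j : Fin n) : cone S ⟶ coneGlue S n :=
  WidePushout.ι (fun _ : Fin n => coneι S) j

lemma coneι_glueι (i j : Fin n) : coneι S ≫ glueι S i = coneι S ≫ glueι S j :=
  (WidePushout.arrow_ι (fun _ : Fin n => coneι S) i).trans
    (WidePushout.arrow_ι (fun _ : Fin n => coneι S) j).symm

variable {S}

lemma coneGlue_hom_ext [NeZero n] {T : C} {f g : coneGlue S n ⟶ T}
    (h : ∀ j, glueι S j ≫ f = glueι S j ≫ g) : f = g := by
  refine WidePushout.hom_ext _ _ _ h ?_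
  have e := WidePushout.arrow_ι (fun _ : Fin n => coneι S) 0
  rw [← e]
  exact ((Category.assoc _ _ _).trans (congrArg _ (h 0))).trans (Category.assoc _ _ _).symm

/-- A family of morphisms from the cones with a common restriction glues. -/
def glueDesc [NeZero n] {T : C} (f : Fin n → (cone S ⟶ T))
    (h : ∀ i j, coneι S ≫ f i = coneι S ≫ f j) : coneGlue S n ⟶ T :=
  WidePushout.desc (coneι S ≫ f 0) f (fun j => h j 0)

@[simp]
lemma ι_glueDesc [NeZero n] {T : C} (f : Fin n → (cone S ⟶ T))
    (h : ∀ i j, coneι S ≫ f i = coneι S ≫ f j) (j : Fin n) :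
    glueι S j ≫ glueDesc f h = f j :=
  WidePushout.ι_desc _ _ _ _ j

@[simp]
lemma ι_glueDesc_assoc [NeZero n] {T T' : C} (f : Fin n → (cone S ⟶ T))
    (h : ∀ i j, coneι S ≫ f i = coneι S ≫ f j) (j : Fin n) (t : T ⟶ T') :
    glueι S j ≫ glueDesc f h ≫ t = f j ≫ t := by
  rw [← Category.assoc, ι_glueDesc f h j]

variable (S) in
/-- Reindexing the cones. -/
def glueMap {m : ℕ} [NeZero m] (φ : Fin m → Fin n) : coneGlue S m ⟶ coneGlue S n :=
  glueDesc (fun j => glueι S (φ j)) (fun _ _ => coneι_glueι _ _ _)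

@[simp]
lemma ι_glueMap {m : ℕ} [NeZero m] (φ : Fin m → Fin n) (j : Fin m) :
    glueι S j ≫ glueMap S φ = glueι S (φ j) :=
  ι_glueDesc _ _ _

@[simp]
lemma ι_glueMap_assoc {m : ℕ} [NeZero m] (φ : Fin m → Fin n) (j : Fin m) {T : C}
    (t : coneGlue S n ⟶ T) : glueι S j ≫ glueMap S φ ≫ t = glueι S (φ j) ≫ t := by
  rw [← Category.assoc, ι_glueMap φ j]

lemma glueMap_comp {m l : ℕ} [NeZero m] [NeZero l] (φ : Fin l → Fin m) (ψ : Fin m → Fin n) :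
    glueMap S φ ≫ glueMap S ψ = glueMap S (ψ ∘ φ) :=
  coneGlue_hom_ext (fun j => by simp)

variable (n) in
/-- The functoriality in the base. -/
def glueBase [NeZero n] {S' : C} (f : S ⟶ S') : coneGlue S n ⟶ coneGlue S' n :=
  glueDesc (fun j => coneMap f ≫ glueι S' j) (fun i j => by
    rw [← Category.assoc, ← Category.assoc, coneι_coneMap, Category.assoc, Category.assoc,
      coneι_glueι])

@[simp]
lemma ι_glueBase [NeZero n] {S' : C} (f : S ⟶ S') (j : Fin n) :
    glueι S j ≫ glueBase n f = coneMap f ≫ glueι S' j :=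
  ι_glueDesc _ _ _

@[simp]
lemma ι_glueBase_assoc [NeZero n] {S' : C} (f : S ⟶ S') (j : Fin n) {T : C}
    (t : coneGlue S' n ⟶ T) : glueι S j ≫ glueBase n f ≫ t = coneMap f ≫ glueι S' j ≫ t := by
  rw [← Category.assoc, ι_glueBase f j, Category.assoc]

lemma glueMap_glueBase {m : ℕ} [NeZero m] [NeZero n] {S' : C} (φ : Fin m → Fin n) (f : S ⟶ S') :
    glueMap S φ ≫ glueBase n f = glueBase m f ≫ glueMap S' φ :=
  coneGlue_hom_ext (fun j => by simp)

variable (S) in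
lemma isPushout_coneGlue_two : IsPushout (coneι S) (coneι S) (glueι S (0 : Fin 2)) (glueι S 1) := by
  refine ⟨⟨coneι_glueι _ _ _⟩, ⟨PushoutCocone.IsColimit.mk _
    (fun s => glueDesc ![s.inl, s.inr] ?_) ?_ ?_ ?_⟩⟩
  · intro i j
    fin_cases i <;> fin_cases j <;> simp [s.condition]
  · intro s; simp
  · intro s; simp
  · intro s m h₁ h₂
    refine coneGlue_hom_ext (fun j => ?_)
    fin_cases j <;> simp [h₁, h₂]

variable (S n) in
-- With the cones regarded as vertices, this attaches one more edge at the last vertex. The gluing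
-- takes place along a whole cone, which is contractible, so the union becomes a coproduct in the
-- homotopy category.
lemma isPushout_coneGlue_succ [NeZero n] :
    IsPushout (glueι S (Fin.last n)) (glueι S 0) (glueMap S Fin.castSucc)
      (glueMap S ![(Fin.last n).castSucc, Fin.last (n + 1)]) := by
  refine ⟨⟨by simp⟩, ⟨PushoutCocone.IsColimit.mk _
    (fun s => glueDesc (Fin.lastCases (glueι S 1 ≫ s.inr) (fun j => glueι S j ≫ s.inl)) ?_)
    ?_ ?_ ?_⟩⟩
  · have key : coneι S ≫ glueι S 1 ≫ s.inr = coneι S ≫ glueι S (Fin.last n) ≫ s.inl := by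
      rw [s.condition, ← Category.assoc, ← Category.assoc, coneι_glueι]
    have h (i : Fin (n + 2)) : coneι S ≫ (Fin.lastCases (glueι S 1 ≫ s.inr)
        (fun j => glueι S j ≫ s.inl) i : cone S ⟶ s.pt) =
        coneι S ≫ glueι S (Fin.last n) ≫ s.inl := by
      refine Fin.lastCases ?_ (fun j => ?_) i
      · simpa using key
      · simp only [Fin.lastCases_castSucc]
        rw [← Category.assoc, ← Category.assoc, coneι_glueι]
    exact fun i j => (h i).trans (h j).symm
  · intro s
    refine coneGlue_hom_ext (fun j => by simp)
  · intro s
    refine coneGlue_hom_ext (fun j => ?_)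
    fin_cases j
    · simpa using s.condition
    · simp
  · intro s m h₁ h₂
    refine coneGlue_hom_ext (fun j => ?_)
    refine Fin.lastCases ?_ (fun j => ?_) j
    · simp [← h₂]
    · simp [← h₁]

instance : Cofibration (glueι S (0 : Fin 2)) := by
  rw [cofibration_iff]
  exact MorphismProperty.of_isPushout (isPushout_coneGlue_two S) (mem_cofibrations _)

instance : Cofibration (glueι S (1 : Fin 2)) := by
  rw [cofibration_iff]
  exact MorphismProperty.of_isPushout (isPushout_coneGlue_two S).flip (mem_cofibrations _)

instance : Cofibration (glueι S (2 : Fin 3)) := by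
  have : Cofibration (glueMap S ![(Fin.last 1).castSucc, Fin.last 2]) := by
    rw [cofibration_iff]
    exact MorphismProperty.of_isPushout (isPushout_coneGlue_succ S 1).flip
      (mem_cofibrations (glueι S (1 : Fin 2)))
  have e : glueι S (2 : Fin 3) = glueι S 1 ≫ glueMap S ![(Fin.last 1).castSucc, Fin.last 2] := by
    rw [ι_glueMap]; rfl
  rw [e]
  infer_instance

end Gluing


/-! ### The group of morphisms out of a suspension -/

section HomGroup

variable {C : Type u} [Category.{v} C] [ModelCategory C] [HasZeroObject C] [HasZeroMorphisms C]
  {S : C} [IsCofibrant S] {T : Ho C}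

open ZeroObject

/-- Restriction along the reindexing of the cones. -/
def glueFace {m n : ℕ} [NeZero m] (φ : Fin m → Fin n) (z : (toHo C).obj (coneGlue S n) ⟶ T) :
    (toHo C).obj (coneGlue S m) ⟶ T :=
  (toHo C).map (glueMap S φ) ≫ z

omit [IsCofibrant S] in
lemma glueFace_glueFace {l m n : ℕ} [NeZero l] [NeZero m] (φ : Fin l → Fin m) (ψ : Fin m → Fin n)
    (z : (toHo C).obj (coneGlue S n) ⟶ T) :
    glueFace φ (glueFace ψ z) = glueFace (ψ ∘ φ) z := by
  simp only [glueFace]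
  rw [← Functor.map_comp_assoc, glueMap_comp]

omit [IsCofibrant S] in
lemma glueFace_id (z : (toHo C).obj (coneGlue S 2) ⟶ T) : glueFace ![0, 1] z = z := by
  have : glueMap S (![0, 1] : Fin 2 → Fin 2) = 𝟙 _ :=
    coneGlue_hom_ext (fun j => by fin_cases j <;> simp)
  rw [glueFace, this, CategoryTheory.Functor.map_id, Category.id_comp]

/-- This is a Segal condition: a triangle is determined by two consecutive edges, chosen
arbitrarily. Its third edge defines the sum `glueAdd`. -/
lemma existsUnique_glueFace (x y : (toHo C).obj (coneGlue S 2) ⟶ T) :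
    ∃! z : (toHo C).obj (coneGlue S 3) ⟶ T, glueFace ![0, 1] z = x ∧ glueFace ![1, 2] z = y := by
  have e : (Fin.castSucc : Fin 2 → Fin 3) = ![0, 1] := by decide
  have e' : (![(Fin.last 1).castSucc, Fin.last (1 + 1)] : Fin 2 → Fin 3) = ![1, 2] := by decide
  have h := isPushout_coneGlue_succ S 1
  rw [e', e] at h
  have : Cofibration (glueι S (Fin.last 1)) := inferInstanceAs (Cofibration (glueι S (1 : Fin 2)))
  exact existsUnique_of_isPushout_of_contractible h (weakEquivalence_zero_cone S) x y

lemma exists_glueFace (x : (toHo C).obj (coneGlue S 3) ⟶ T)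
    (y : (toHo C).obj (coneGlue S 2) ⟶ T) :
    ∃ z : (toHo C).obj (coneGlue S 4) ⟶ T,
      glueFace ![0, 1, 2] z = x ∧ glueFace ![2, 3] z = y := by
  have e : (Fin.castSucc : Fin 3 → Fin 4) = ![0, 1, 2] := by decide
  have e' : (![(Fin.last 2).castSucc, Fin.last (2 + 1)] : Fin 2 → Fin 4) = ![2, 3] := by decide
  have h := isPushout_coneGlue_succ S 2
  rw [e', e] at h
  have : Cofibration (glueι S (Fin.last 2)) := inferInstanceAs (Cofibration (glueι S (2 : Fin 3)))
  exact (existsUnique_of_isPushout_of_contractible h (weakEquivalence_zero_cone S) x y).exists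

omit [IsCofibrant S] in
-- A degenerate edge factors through a single cone, which is a zero object in the homotopy category.
lemma glueFace_const [HasZeroMorphisms (Ho C)] {n : ℕ} (i : Fin n)
    (z : (toHo C).obj (coneGlue S n) ⟶ T) :
    glueFace ![i, i] z = 0 := by
  have e : glueMap S ![i, i] = glueDesc (n := 2) (fun _ => 𝟙 (cone S)) (fun _ _ => rfl) ≫
      glueι S i := coneGlue_hom_ext (fun j => by fin_cases j <;> simp)
  have h : IsZero ((toHo C).obj (cone S)) := by
    have := weakEquivalence_zero_cone S
    have := isIso_toHo_map (0 : cone S ⟶ (0 : C))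
    exact (isZero_toHo_obj (isZero_zero C)).of_iso (asIso ((toHo C).map (0 : cone S ⟶ (0 : C))))
  rw [glueFace, e, Functor.map_comp, h.eq_zero_of_tgt ((toHo C).map (glueDesc _ _)), zero_comp,
    zero_comp]

/-- The composition of two consecutive edges. -/
def glueAdd (x y : (toHo C).obj (coneGlue S 2) ⟶ T) : (toHo C).obj (coneGlue S 2) ⟶ T :=
  glueFace ![0, 2] (existsUnique_glueFace x y).choose

lemma glueAdd_glueFace (z : (toHo C).obj (coneGlue S 3) ⟶ T) :
    glueAdd (glueFace ![0, 1] z) (glueFace ![1, 2] z) = glueFace ![0, 2] z := by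
  have h := existsUnique_glueFace (glueFace ![0, 1] z) (glueFace ![1, 2] z)
  rw [glueAdd, h.unique h.choose_spec.1 ⟨rfl, rfl⟩]

/-- The vertices may repeat and come in any order, so the units, inverses and associativity are all
instances of this rule. -/
lemma glueAdd_face {n : ℕ} (z : (toHo C).obj (coneGlue S n) ⟶ T) (i j k : Fin n) :
    glueAdd (glueFace ![i, j] z) (glueFace ![j, k] z) = glueFace ![i, k] z := by
  have h := glueAdd_glueFace (glueFace ![i, j, k] z)
  simp only [glueFace_glueFace] at h
  convert! h using 3 <;> (ext a; fin_cases a <;> rfl)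

/-- The group structure on morphisms out of a suspension, given by the composition of edges in
the groupoid of cones. -/
abbrev glueAddGroup [HasZeroMorphisms (Ho C)] :
    AddGroup ((toHo C).obj (coneGlue S 2) ⟶ T) :=
  letI : Add ((toHo C).obj (coneGlue S 2) ⟶ T) := ⟨glueAdd⟩
  letI : Neg ((toHo C).obj (coneGlue S 2) ⟶ T) := ⟨glueFace ![1, 0]⟩
  AddGroup.ofLeftAxioms
    (fun x y w => by
      obtain ⟨z, ⟨rfl, rfl⟩, -⟩ := existsUnique_glueFace x y
      -- The three summands become the consecutive edges 01, 12, 23 of one element on four cones;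
      -- both bracketings are its edge 03.
      obtain ⟨Z, rfl, rfl⟩ := exists_glueFace z w
      change glueAdd (glueAdd _ _) _ = glueAdd _ (glueAdd _ _)
      simp only [glueFace_glueFace]
      have h₁ : (![0, 1, 2] ∘ ![0, 1] : Fin 2 → Fin 4) = ![0, 1] := by decide
      have h₂ : (![0, 1, 2] ∘ ![1, 2] : Fin 2 → Fin 4) = ![1, 2] := by decide
      rw [h₁, h₂]
      simp only [glueAdd_face])
    (fun x => by
      change glueAdd 0 x = x
      nth_rw 1 [← glueFace_const 0 x]
      nth_rw 2 [← glueFace_id x]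
      rw [glueAdd_face, glueFace_id])
    (fun x => by
      change glueAdd (glueFace ![1, 0] x) x = 0
      nth_rw 2 [← glueFace_id x]
      rw [glueAdd_face, glueFace_const])

lemma glueAdd_comp {T' : Ho C} (x y : (toHo C).obj (coneGlue S 2) ⟶ T) (g : T ⟶ T') :
    glueAdd x y ≫ g = glueAdd (x ≫ g) (y ≫ g) := by
  obtain ⟨z, ⟨rfl, rfl⟩, -⟩ := existsUnique_glueFace x y
  have h {m n : ℕ} [NeZero m] (φ : Fin m → Fin n) (z : (toHo C).obj (coneGlue S n) ⟶ T) :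
      glueFace φ z ≫ g = glueFace φ (z ≫ g) := Category.assoc _ _ _
  rw [h, h, glueAdd_face, glueAdd_face, h]

lemma comp_glueAdd {S' : C} [IsCofibrant S'] (f : S ⟶ S')
    (x y : (toHo C).obj (coneGlue S' 2) ⟶ T) :
    (toHo C).map (glueBase 2 f) ≫ glueAdd x y =
      glueAdd ((toHo C).map (glueBase 2 f) ≫ x) ((toHo C).map (glueBase 2 f) ≫ y) := by
  obtain ⟨z, ⟨rfl, rfl⟩, -⟩ := existsUnique_glueFace x y
  have h (φ : Fin 2 → Fin 3) : (toHo C).map (glueBase 2 f) ≫ glueFace φ z =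
      glueFace φ ((toHo C).map (glueBase 3 f) ≫ z) := by
    simp only [glueFace]
    rw [← Functor.map_comp_assoc, ← Functor.map_comp_assoc, glueMap_glueBase]
  rw [h, h, glueAdd_face, glueAdd_face, h]

variable (S) in
/-- The union of two cones is the suspension. -/
lemma exists_coneGlue_two_iso :
    ∃ q : (toHo C).obj (coneGlue S 2) ≅ (toHo C).obj (suspObj S),
      ∃ p : coneGlue S 2 ⟶ suspObj S, q.hom = (toHo C).map p ∧
        glueι S 0 ≫ p = cokernel.π _ ∧ glueι S 1 ≫ p = 0 := by
  let e := (isPushout_coneGlue_two S).isoPushout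
  have := weakEquivalence_mappingConeToCokernel (coneι S)
  have := isIso_toHo_map (mappingConeToCokernel (coneι S))
  refine ⟨(toHo C).mapIso e ≪≫ asIso ((toHo C).map (mappingConeToCokernel (coneι S))),
    e.hom ≫ mappingConeToCokernel (coneι S), by simp, ?_, ?_⟩
  · rw [IsPushout.inl_isoPushout_hom_assoc, inl_mappingConeToCokernel]
  · rw [IsPushout.inr_isoPushout_hom_assoc, inr_mappingConeToCokernel]

/-- Up to isomorphism every morphism of the homotopy category is induced by a morphism of bases. -/
lemma exists_toHo_map_glueBase_eq [IsStable C] {S' : C} [IsCofibrant S'] [IsFibrant S']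
    (g : (toHo C).obj (coneGlue S 2) ⟶ (toHo C).obj (coneGlue S' 2)) :
    ∃ f : S ⟶ S', (toHo C).map (glueBase 2 f) = g := by
  obtain ⟨q, p, hq, hp₀, hp₁⟩ := exists_coneGlue_two_iso S
  obtain ⟨q', p', hq', hp₀', hp₁'⟩ := exists_coneGlue_two_iso S'
  have := IsStable.isEquivalence_suspension (C := C)
  -- Fullness of the suspension desuspends `g`; as `S` is cofibrant and `S'` is fibrant, the result
  -- is represented by a morphism of bases.
  obtain ⟨k, hk⟩ := (suspension C).map_surjective
    ((suspensionIso S).hom ≫ q.inv ≫ g ≫ q'.hom ≫ (suspensionIso S').inv)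
  obtain ⟨f, rfl⟩ := exists_toHo_map_eq k
  have hk' : (toHo C).map (suspMap f) = q.inv ≫ g ≫ q'.hom := by
    rw [← cancel_epi (suspensionIso S).hom, ← suspensionIso_naturality, hk]
    simp
  refine ⟨f, ?_⟩
  have e : glueBase 2 f ≫ p' = p ≫ suspMap f := by
    refine coneGlue_hom_ext (fun j => ?_)
    fin_cases j
    · simp [hp₀', reassoc_of% hp₀, suspMap]
    · simp [hp₁', reassoc_of% hp₁]
  rw [← cancel_mono q'.hom, hq', ← Functor.map_comp, e, Functor.map_comp, ← hq, hk', ← hq']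
  simp

lemma exists_iso_coneGlue [IsStable C] (X : Ho C) :
    ∃ (S : C) (_ : IsCofibrant S) (_ : IsFibrant S),
      Nonempty (X ≅ (toHo C).obj (coneGlue S 2)) := by
  have := IsStable.isEquivalence_suspension (C := C)
  obtain ⟨S, _, _, ⟨e⟩⟩ := exists_cofibrant_fibrant_iso ((suspension C).objPreimage X)
  obtain ⟨q, -⟩ := exists_coneGlue_two_iso S
  exact ⟨S, inferInstance, inferInstance, ⟨((suspension C).objObjPreimageIso X).symm ≪≫
    (suspension C).mapIso e ≪≫ suspensionIso S ≪≫ q.symm⟩⟩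

end HomGroup

/-! ### Additivity of the homotopy category -/

section Preadditive

/-- A category enriched in groups with bilinear composition is preadditive. -/
abbrev preadditiveOfAddGroup {T : Type u} [Category.{v} T] (G : ∀ X Y : T, AddGroup (X ⟶ Y))
    (h₁ : ∀ (X Y Z : T) (f f' : X ⟶ Y) (g : Y ⟶ Z), (f + f') ≫ g = f ≫ g + f' ≫ g)
    (h₂ : ∀ (X Y Z : T) (f : X ⟶ Y) (g g' : Y ⟶ Z), f ≫ (g + g') = f ≫ g + f ≫ g') :
    Preadditive T where
  homGroup X Y :=
    { G X Y with
      add_comm := fun a b => by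
        -- Commutativity is forced by bilinearity: `(𝟙 + 𝟙) ≫ (b + a)` is expanded in both orders,
        -- and the outer terms `b` and `a` are cancelled.
        have e₁ := h₁ X X Y (𝟙 X) (𝟙 X) (b + a)
        have e₂ := h₂ X X Y (𝟙 X + 𝟙 X) b a
        rw [e₂, h₁, h₁] at e₁
        simp only [Category.id_comp] at e₁
        rw [add_assoc, add_assoc, add_left_cancel_iff, ← add_assoc, ← add_assoc,
          add_right_cancel_iff] at e₁
        exact e₁.symm }
  add_comp := h₁
  comp_add := h₂

variable (C : Type u) [Category.{v} C] [ModelCategory C] [HasZeroObject C] [HasZeroMorphisms C]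
  [IsStable C]

/-- The homotopy category of a stable model category is preadditive. -/
lemma nonempty_preadditive : Nonempty (Preadditive (Ho C)) := by
  let _ : HasZeroMorphisms (Ho C) := HasZeroObject.zeroMorphismsOfZeroObject
  -- By stability every object is a suspension, so its morphism groups can be transported from a
  -- union of two cones.
  choose S h₁ h₂ e using exists_iso_coneGlue (C := C)
  let e' (X : Ho C) := (e X).some
  let G (X Y : Ho C) : AddGroup (X ⟶ Y) :=
    letI := glueAddGroup (S := S X) (T := Y)
    (Iso.homCongr (e' X) (Iso.refl Y)).addGroup
  have add_def {X Y : Ho C} (f g : X ⟶ Y) :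
      letI := G X Y
      f + g = (e' X).hom ≫ glueAdd ((e' X).inv ≫ f) ((e' X).inv ≫ g) := by
    change (e' X).hom ≫ glueAdd ((e' X).inv ≫ f ≫ 𝟙 _) ((e' X).inv ≫ g ≫ 𝟙 _) ≫ 𝟙 _ = _
    simp only [Category.comp_id]
  refine ⟨preadditiveOfAddGroup G (fun X Y Z f f' g => ?_) (fun X Y Z f g g' => ?_)⟩
  · rw [add_def, add_def, Category.assoc, glueAdd_comp]
    simp only [Category.assoc]
  · rw [add_def, add_def]
    -- Precomposition with an arbitrary morphism need not respect the cones; precomposition with one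
    -- induced from the bases does, and stability makes every morphism of this kind.
    obtain ⟨k, hk⟩ := exists_toHo_map_glueBase_eq ((e' X).inv ≫ f ≫ (e' Y).hom)
    have hf : f = (e' X).hom ≫ (toHo C).map (glueBase 2 k) ≫ (e' Y).inv := by simp [hk]
    rw [hf]
    simp only [Category.assoc, Iso.inv_hom_id_assoc]
    rw [comp_glueAdd]

end Preadditive


/-! ### Localising subcategories and five lemmas -/

section Localising

variable {C : Type u} [Category.{v} C] [ModelCategory C] [HasZeroObject C] [HasZeroMorphisms C]

/-- A class closed under suspension, desuspension, coproducts and cofibers is localising. -/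
lemma IsLocalising.of_cofiber {P : ObjectProperty (Ho C)} (zero : ∀ X, IsZero X → P X)
    (suspension_iff : ∀ X, P ((suspension C).obj X) ↔ P X)
    (cofiber : ∀ {X Y Z : Ho C} (f : X ⟶ Y) (g : Y ⟶ Z), IsCofiberSequence f g →
      P X → P Y → P Z)
    (coproduct : ∀ (I : Type w), P.IsClosedUnderColimitsOfShape (Discrete I)) :
    IsLocalising.{w} P where
  zero := zero
  suspension_iff := suspension_iff
  -- Rotation exhibits the suspension of the missing term as a cofiber of objects of the class;
  -- closure under desuspension then concludes.
  two_of_three₁ f g h hY hZ := by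
    obtain ⟨δ, hδ⟩ := h.rotate
    exact (suspension_iff _).1 (cofiber _ _ hδ hY hZ)
  two_of_three₂ f g h hX hZ := by
    obtain ⟨δ, hδ⟩ := h.rotate
    obtain ⟨ε, hε⟩ := hδ.rotate
    exact (suspension_iff _).1 (cofiber _ _ hε hZ ((suspension_iff _).2 hX))
  two_of_three₃ f g h hX hY := cofiber f g h hX hY
  coproduct := coproduct

/-- The five lemma for morphisms out of a cofiber sequence. -/
lemma IsCofiberSequence.bijective_comp [Preadditive (Ho C)] {X Y Z : Ho C} {f : X ⟶ Y}
    {g : Y ⟶ Z} (h : IsCofiberSequence f g) {A B : Ho C} (φ : A ⟶ B)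
    (hX : Function.Bijective (fun u : X ⟶ A => u ≫ φ))
    (hY : Function.Bijective (fun u : Y ⟶ A => u ≫ φ))
    (hX' : Function.Bijective (fun u : (suspension C).obj X ⟶ A => u ≫ φ))
    (hY' : Function.Bijective (fun u : (suspension C).obj Y ⟶ A => u ≫ φ)) :
    Function.Bijective (fun u : Z ⟶ A => u ≫ φ) := by
  obtain ⟨δ, h₁⟩ := h.rotate
  obtain ⟨ε, h₂⟩ := h₁.rotate
  have c := h.isWeakCokernel
  have c₁ := h₁.isWeakCokernel
  have c₂ := h₂.isWeakCokernel
  constructor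
  · intro u₁ u₂ hu
    rw [← sub_eq_zero] at hu ⊢
    simp only [← Preadditive.sub_comp] at hu
    set u := u₁ - u₂
    -- Diagram chase along `X ⟶ Y ⟶ Z ⟶ ΣX ⟶ ΣY`, using only weak cokernels.
    obtain ⟨a, ha⟩ := c₁.exists_desc u (hY.1 (by simp [hu]))
    obtain ⟨b, hb⟩ := c₂.exists_desc (a ≫ φ) (by rw [reassoc_of% ha, hu])
    obtain ⟨b', rfl⟩ := hY'.2 b
    have : a = ε ≫ b' := hX'.1 (by simp [← hb])
    rw [← ha, this, reassoc_of% c₂.zero, zero_comp]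
  · intro t
    obtain ⟨y, hy⟩ := hY.2 (g ≫ t)
    dsimp only at hy
    obtain ⟨z, hz⟩ := c.exists_desc y (hX.1 (by
      simp only [Category.assoc, hy, reassoc_of% c.zero, zero_comp]))
    obtain ⟨s, hs⟩ := c₁.exists_desc (t - z ≫ φ) (by
      rw [Preadditive.comp_sub, reassoc_of% hz, hy, sub_self])
    obtain ⟨s', rfl⟩ := hX'.2 s
    refine ⟨z + δ ≫ s', ?_⟩
    simp only [Preadditive.add_comp, Category.assoc] at hs ⊢
    rw [hs, add_sub_cancel]

/-- The five lemma for morphisms into a sequence of weak kernels. -/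
lemma isIso_of_isWeakKernel {T : Type u} [Category.{v} T] [Preadditive T]
    {X : Fin 5 → T} {Y : Fin 5 → T} {f : X 0 ⟶ X 1} {g : X 1 ⟶ X 2} {h : X 2 ⟶ X 3}
    {k : X 3 ⟶ X 4} {f' : Y 0 ⟶ Y 1} {g' : Y 1 ⟶ Y 2} {h' : Y 2 ⟶ Y 3} {k' : Y 3 ⟶ Y 4}
    (hf : IsWeakKernel f g) (hg : IsWeakKernel g h) (hh : IsWeakKernel h k)
    (hf' : IsWeakKernel f' g') (hg' : IsWeakKernel g' h') (hh' : IsWeakKernel h' k')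
    (η : ∀ i, X i ⟶ Y i) (e₀ : f ≫ η 1 = η 0 ≫ f') (e₁ : g ≫ η 2 = η 1 ≫ g')
    (e₂ : h ≫ η 3 = η 2 ≫ h') (e₃ : k ≫ η 4 = η 3 ≫ k')
    [IsIso (η 0)] [IsIso (η 1)] [IsIso (η 3)] [IsIso (η 4)] : IsIso (η 2) := by
  refine isIso_of_yoneda_map_bijective _ (fun S => ⟨fun u₁ u₂ hu => ?_, fun t => ?_⟩)
  · rw [← sub_eq_zero] at hu ⊢
    simp only [← Preadditive.sub_comp] at hu
    set u := u₁ - u₂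
    obtain ⟨v, hv⟩ := hg.exists_lift u (by
      rw [← cancel_mono (η 3), Category.assoc, e₂, reassoc_of% hu, zero_comp, zero_comp])
    obtain ⟨w, hw⟩ := hf'.exists_lift (v ≫ η 1) (by
      rw [Category.assoc, ← e₁, reassoc_of% hv, hu])
    have : v = (w ≫ inv (η 0)) ≫ f := by
      rw [← cancel_mono (η 1), Category.assoc, Category.assoc, e₀, IsIso.inv_hom_id_assoc, hw]
    rw [← hv, this, Category.assoc, hf.zero, comp_zero]
  · obtain ⟨u, hu⟩ := hh.exists_lift (t ≫ h' ≫ inv (η 3)) (by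
      rw [← cancel_mono (η 4), Category.assoc, Category.assoc, Category.assoc, e₃,
        IsIso.inv_hom_id_assoc, hh'.zero, comp_zero, zero_comp])
    obtain ⟨v, hv⟩ := hg'.exists_lift (t - u ≫ η 2) (by
      rw [Preadditive.sub_comp, Category.assoc, ← e₂, reassoc_of% hu, IsIso.inv_hom_id,
        Category.comp_id, sub_self])
    refine ⟨u + v ≫ inv (η 1) ≫ g, ?_⟩
    simp only [Preadditive.add_comp, Category.assoc, e₁, IsIso.inv_hom_id_assoc, hv,
      add_sub_cancel]

lemma bijective_iff_of_equiv {α α' β β' : Type*} (e : α ≃ α') (e' : β ≃ β') {f : α → β}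
    {g : α' → β'} (h : ∀ a, e' (f a) = g (e a)) : Function.Bijective f ↔ Function.Bijective g := by
  rw [← e'.comp_bijective, ← Function.Bijective.of_comp_iff g e.bijective]
  exact iff_of_eq (congrArg _ (funext h))

lemma bijective_comp_map_iff {T : Type u} [Category.{v} T] {T' : Type u'} [Category.{v'} T']
    {G : T ⥤ T'} {H : T' ⥤ T} (adj : G ⊣ H) (X : T) {A B : T'} (φ : A ⟶ B) :
    Function.Bijective (fun u : G.obj X ⟶ A => u ≫ φ) ↔
      Function.Bijective (fun u : X ⟶ H.obj A => u ≫ H.map φ) :=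
  bijective_iff_of_equiv (adj.homEquiv X A) (adj.homEquiv X B)
    (fun u => adj.homEquiv_naturality_right u φ)

/-- The objects which see all morphisms of a class closed under suspension and desuspension
as isomorphisms form a localising subcategory. -/
lemma isLocalising_isColocal [Preadditive (Ho C)] (e : Ho C ≌ Ho C)
    (he : e.functor = suspension C) (Φ : MorphismProperty (Ho C))
    (h₁ : Φ ≤ Φ.inverseImage e.functor) (h₂ : Φ ≤ Φ.inverseImage e.inverse) :
    IsLocalising.{w} Φ.isColocal := by
  have hs (X : Ho C) : Φ.isColocal (e.functor.obj X) ↔ Φ.isColocal X := by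
    -- Desuspension uses full faithfulness and closure of `Φ` under suspension; suspension uses the
    -- adjunction with the inverse and closure of `Φ` under desuspension.
    refine ⟨fun h A B φ hφ => ?_, fun h A B φ hφ => ?_⟩
    · refine (bijective_iff_of_equiv (e.fullyFaithfulFunctor.homEquiv (X := X) (Y := A))
        (e.fullyFaithfulFunctor.homEquiv) (fun u => ?_)).2 (h _ (h₁ _ hφ))
      exact e.functor.map_comp u φ
    · rw [bijective_comp_map_iff e.toAdjunction]
      exact h _ (h₂ _ hφ)
  rw [he] at hs
  refine .of_cofiber (fun X hX A B φ hφ => ?_) hs (fun f g h hX hY A B φ hφ => ?_)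
    (fun I => inferInstance)
  · exact ⟨fun _ _ _ => hX.eq_of_src _ _, fun t => ⟨hX.to_ _, hX.eq_of_src _ _⟩⟩
  · exact h.bijective_comp φ (hX φ hφ) (hY φ hφ) ((hs _).2 hX φ hφ) ((hs _).2 hY φ hφ)

end Localising


/-! ### Derived functors and their adjunction -/

section DerivedAdjunction

variable {C : Type u} [Category.{v} C] [ModelCategory C]

/-- A natural transformation between functors on the homotopy category may be defined on
cofibrant objects. -/
lemma exists_natTrans_app {E : Type*} [Category* E] {G H : Ho C ⥤ E}
    (τ : (CofibrantObject.ι ⋙ toHo C) ⋙ G ⟶ (CofibrantObject.ι ⋙ toHo C) ⋙ H) :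
    ∃ γ : G ⟶ H, ∀ A : CofibrantObject C, γ.app ((toHo C).obj A.obj) = τ.app A :=
  ⟨(Localization.whiskeringLeftFunctor' (CofibrantObject.ι ⋙ toHo C)
      (weakEquivalences (CofibrantObject C)) E).preimage τ,
    congr_app (Functor.map_preimage (Localization.whiskeringLeftFunctor'
      (CofibrantObject.ι ⋙ toHo C) (weakEquivalences (CofibrantObject C)) E) τ)⟩

/-- A functor on the homotopy category which agrees on cofibrant objects with a given functor is
its left derived functor. -/
lemma isLeftDerivedFunctor_of_isIso {E : Type*} [Category* E] {G : Ho C ⥤ E} {F : C ⥤ E}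
    (α : toHo C ⋙ G ⟶ F) (hα : ∀ A : C, IsCofibrant A → IsIso (α.app A)) :
    G.IsLeftDerivedFunctor α (weakEquivalences C) := by
  have : IsIso (Functor.whiskerLeft CofibrantObject.ι α) :=
    (NatTrans.isIso_iff_isIso_app _).2 (fun A => hα A.obj inferInstance)
  have hq (X : C) : IsIso ((toHo C).map (cofRepHom X)) := isIso_toHo_map _
  -- On cofibrant objects `α` is invertible, so the factorization there is forced. It extends to the
  -- homotopy category, which is also the localization of the cofibrant objects, and is compared
  -- with a general object through its cofibrant replacement.
  have key (H : Functor.RightExtension (toHo C) F) : ∃ γ : H.left ⟶ G,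
      Functor.whiskerLeft (toHo C) γ ≫ α = H.hom := by
    obtain ⟨γ, hγ⟩ := exists_natTrans_app (G := H.left) (H := G)
      (Functor.whiskerLeft CofibrantObject.ι H.hom ≫
        inv (Functor.whiskerLeft CofibrantObject.ι α))
    have fac₀ (A : CofibrantObject C) :
        γ.app ((toHo C).obj A.obj) ≫ α.app A.obj = H.hom.app A.obj := by
      have h := congr_app (IsIso.inv_hom_id (Functor.whiskerLeft CofibrantObject.ι α)) A
      have e := hγ A
      dsimp at e h
      rw [e, Category.assoc, h, Category.comp_id]
    refine ⟨γ, ?_⟩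
    ext X
    have hX := fac₀ (CofibrantObject.mk (cofRep X))
    have n₁ := α.naturality (cofRepHom X)
    have n₂ := H.hom.naturality (cofRepHom X)
    dsimp at hX n₁ n₂ ⊢
    rw [← cancel_epi (H.left.map ((toHo C).map (cofRepHom X))), n₂, ← hX,
      NatTrans.naturality_assoc, n₁, Category.assoc]
  choose γ hγ using key
  refine ⟨⟨⟨IsTerminal.ofUniqueHom (fun H => CostructuredArrow.homMk (γ H) (hγ H))
    (fun H m => ?_)⟩⟩⟩
  apply CostructuredArrow.hom_ext
  have : Functor.EssSurj (CofibrantObject.ι ⋙ toHo C) :=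
    Localization.essSurj _ (weakEquivalences (CofibrantObject C))
  have hm : Functor.whiskerLeft (toHo C) m.left ≫ α = H.hom := CostructuredArrow.w m
  refine Localization.natTrans_ext (CofibrantObject.ι ⋙ toHo C)
    (weakEquivalences (CofibrantObject C)) (fun A => ?_)
  have := hα A.obj inferInstance
  have h₁ := congr_app hm A.obj
  have h₂ := congr_app (hγ H) A.obj
  rw [← h₂] at h₁
  exact (cancel_mono (α.app A.obj)).1 h₁

/-- A functor on the homotopy category which agrees on fibrant objects with a given functor is
its right derived functor. -/
lemma isRightDerivedFunctor_of_isIso {E : Type*} [Category* E] {G : Ho C ⥤ E} {U : C ⥤ E}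
    (β : U ⟶ toHo C ⋙ G) (hβ : ∀ A : C, IsFibrant A → IsIso (β.app A)) :
    G.IsRightDerivedFunctor β (weakEquivalences C) := by
  have hβ' (A : FibrantObject C) : IsIso (β.app A.obj) := hβ A.obj inferInstance
  refine LocalizerMorphism.Derives.isRightDerivedFunctor_of_isIso
    (Φ := FibrantObject.localizerMorphism C) (fun A B f hf => ?_) β hβ'
  have hw : WeakEquivalence f.hom := by
    rwa [← weakEquivalence_iff_of_objectProperty, weakEquivalence_iff]
  have := isIso_toHo_map f.hom
  have := hβ' A
  have := hβ' B
  -- That `U` inverts weak equivalences between fibrant objects is not assumed: it follows from its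
  -- agreement there with a functor on the homotopy category.
  have n := β.naturality f.hom
  have : IsIso (U.map f.hom ≫ β.app B.obj) := by
    rw [n]
    dsimp
    infer_instance
  exact IsIso.of_isIso_comp_right (U.map f.hom) (β.app B.obj)

variable {D : Type u'} [Category.{v'} D] [ModelCategory D] {F : C ⥤ D} {U : D ⥤ C}
  {adj : F ⊣ U} (h : IsQuillenPair adj)

namespace IsQuillenPair

include h

/-- On cofibrant objects, the left derived functor is given by `F`. -/
def leftDerivedIso : CofibrantObject.ι ⋙ toHo C ⋙ h.leftDerived ≅
    CofibrantObject.ι ⋙ F ⋙ toHo D :=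
  Localization.fac _ h.left_inverts (CofibrantObject.ι ⋙ toHo C)

/-- On fibrant objects, the right derived functor is given by `U`. -/
def rightDerivedIso : FibrantObject.ι ⋙ toHo D ⋙ h.rightDerived ≅
    FibrantObject.ι ⋙ U ⋙ toHo C :=
  Localization.fac _ h.right_inverts (FibrantObject.ι ⋙ toHo D)

/-- The comparison of the left derived functor with `F`. -/
def leftDerivedCounit : toHo C ⋙ h.leftDerived ⟶ F ⋙ toHo D where
  app X := haveI := isIso_toHo_map (cofRepHom X)
    h.leftDerived.map (inv ((toHo C).map (cofRepHom X))) ≫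
      h.leftDerivedIso.hom.app (CofibrantObject.mk (cofRep X)) ≫
        (toHo D).map (F.map (cofRepHom X))
  naturality X Y f := by
    have := isIso_toHo_map (cofRepHom X)
    have := isIso_toHo_map (cofRepHom Y)
    have n := h.leftDerivedIso.hom.naturality (X := CofibrantObject.mk (cofRep X))
      (Y := CofibrantObject.mk (cofRep Y)) ⟨CofibrantObject.HoCat.resolutionMap f⟩
    have e := CofibrantObject.HoCat.resolutionMap_fac f
    have e₁ := congrArg (toHo C).map e
    have e₂ := congrArg (fun f => (toHo D).map (F.map f)) e
    simp only [Functor.map_comp] at e₁ e₂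
    dsimp at n ⊢
    have e₃ : h.leftDerived.map ((toHo C).map f) ≫
        h.leftDerived.map (inv ((toHo C).map (cofRepHom Y))) =
          h.leftDerived.map (inv ((toHo C).map (cofRepHom X))) ≫
            h.leftDerived.map ((toHo C).map (CofibrantObject.HoCat.resolutionMap f)) := by
      rw [← Functor.map_comp, ← Functor.map_comp]
      refine congrArg h.leftDerived.map ?_
      rw [IsIso.comp_inv_eq, Category.assoc, e₁,
        IsIso.inv_hom_id_assoc]
    rw [reassoc_of% e₃, reassoc_of% n, e₂]
    simp only [Category.assoc]

/-- The comparison of `U` with the right derived functor. -/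
def rightDerivedUnit : U ⋙ toHo C ⟶ toHo D ⋙ h.rightDerived where
  app X := haveI := isIso_toHo_map (fibRepHom X)
    (toHo C).map (U.map (fibRepHom X)) ≫
      h.rightDerivedIso.inv.app (FibrantObject.mk (fibRep X)) ≫
        h.rightDerived.map (inv ((toHo D).map (fibRepHom X)))
  naturality X Y f := by
    have := isIso_toHo_map (fibRepHom X)
    have := isIso_toHo_map (fibRepHom Y)
    have n := h.rightDerivedIso.inv.naturality (X := FibrantObject.mk (fibRep X))
      (Y := FibrantObject.mk (fibRep Y)) ⟨FibrantObject.HoCat.resolutionMap f⟩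
    have e := FibrantObject.HoCat.resolutionMap_fac f
    have e₁ := congrArg (toHo D).map e
    have e₂ := congrArg (fun f => (toHo C).map (U.map f)) e
    simp only [Functor.map_comp] at e₁ e₂
    dsimp at n ⊢
    have e₃ : h.rightDerived.map (inv ((toHo D).map (fibRepHom X))) ≫
        h.rightDerived.map ((toHo D).map f) =
          h.rightDerived.map ((toHo D).map (FibrantObject.HoCat.resolutionMap f)) ≫
            h.rightDerived.map (inv ((toHo D).map (fibRepHom Y))) := by
      rw [← Functor.map_comp, ← Functor.map_comp]
      refine congrArg h.rightDerived.map ?_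
      rw [IsIso.inv_comp_eq, reassoc_of% e₁,
        IsIso.hom_inv_id, Category.comp_id]
    simp only [Category.assoc]
    rw [e₃, ← reassoc_of% n, reassoc_of% e₂]

lemma isIso_leftDerivedCounit_app (A : C) [IsCofibrant A] :
    IsIso (h.leftDerivedCounit.app A) := by
  have := isIso_toHo_map (cofRepHom A)
  have n := h.leftDerivedIso.hom.naturality (X := CofibrantObject.mk (cofRep A))
    (Y := CofibrantObject.mk A) ⟨cofRepHom A⟩
  dsimp at n
  dsimp [leftDerivedCounit]
  rw [← n, ← Functor.map_comp_assoc]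
  simp
  infer_instance

lemma isIso_rightDerivedUnit_app (B : D) [IsFibrant B] :
    IsIso (h.rightDerivedUnit.app B) := by
  have := isIso_toHo_map (fibRepHom B)
  have n := h.rightDerivedIso.inv.naturality (X := FibrantObject.mk B)
    (Y := FibrantObject.mk (fibRep B)) ⟨fibRepHom B⟩
  dsimp at n
  dsimp [rightDerivedUnit]
  rw [reassoc_of% n, ← Functor.map_comp]
  simp
  infer_instance

instance : h.leftDerived.IsLeftDerivedFunctor h.leftDerivedCounit (weakEquivalences C) :=
  isLeftDerivedFunctor_of_isIso _ (fun A _ => h.isIso_leftDerivedCounit_app A)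

instance : h.rightDerived.IsRightDerivedFunctor h.rightDerivedUnit (weakEquivalences D) :=
  isRightDerivedFunctor_of_isIso _ (fun A _ => h.isIso_rightDerivedUnit_app A)

/-- The derived unit is defined through the universal property of this composite, and the counit
through that of the next one. A derived functor followed by another functor is not derived in
general; here it is, because the comparison is invertible on cofibrant (respectively fibrant)
objects. -/
instance : (h.leftDerived ⋙ h.rightDerived).IsLeftDerivedFunctor
    ((Functor.associator _ _ _).inv ≫ Functor.whiskerRight h.leftDerivedCounit h.rightDerived)
    (weakEquivalences C) :=
  isLeftDerivedFunctor_of_isIso _ (fun A _ => by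
    have := h.isIso_leftDerivedCounit_app A
    dsimp
    infer_instance)

instance : (h.rightDerived ⋙ h.leftDerived).IsRightDerivedFunctor
    (Functor.whiskerRight h.rightDerivedUnit h.leftDerived ≫ (Functor.associator _ _ _).hom)
    (weakEquivalences D) :=
  isRightDerivedFunctor_of_isIso _ (fun A _ => by
    have := h.isIso_rightDerivedUnit_app A
    dsimp
    infer_instance)

/-- The adjunction between the total derived functors of a Quillen pair. -/
def derivedAdjunction : h.leftDerived ⊣ h.rightDerived :=
  adj.derived (weakEquivalences C) (weakEquivalences D) h.leftDerivedCounit h.rightDerivedUnit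

lemma derivedAdjunction_unit_app (X : C) :
    h.derivedAdjunction.unit.app ((toHo C).obj X) ≫
      h.rightDerived.map (h.leftDerivedCounit.app X) =
        (toHo C).map (adj.unit.app X) ≫ h.rightDerivedUnit.app (F.obj X) :=
  adj.derivedη_fac_app (weakEquivalences C) h.leftDerivedCounit h.rightDerivedUnit X

lemma derivedAdjunction_counit_app (Y : D) :
    h.leftDerived.map (h.rightDerivedUnit.app Y) ≫
      h.derivedAdjunction.counit.app ((toHo D).obj Y) =
        h.leftDerivedCounit.app (U.obj Y) ≫ (toHo D).map (adj.counit.app Y) :=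
  adj.derivedε_fac_app (weakEquivalences D) h.leftDerivedCounit h.rightDerivedUnit Y

end IsQuillenPair

end DerivedAdjunction

/-! ### The left derived functor preserves cofiber sequences and suspension -/

section LeftDerivedTriangulated

open ZeroObject

section

variable {C : Type u} [Category.{v} C] [ModelCategory C] [HasZeroObject C] [HasZeroMorphisms C]

/-- The quotient of a contractible object by a subobject is the suspension of the subobject. -/
lemma weakEquivalence_mappingConeToSuspObj {A E : C} (i : A ⟶ E) [IsCofibrant A] [Cofibration i]
    (hE : WeakEquivalence (0 : E ⟶ (0 : C))) :
    WeakEquivalence (pushout.desc 0 (cokernel.π (coneι A)) (by simp) :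
      mappingCone i ⟶ suspObj A) := by
  have : IsCofibrant E := isCofibrant_of_cofibration i
  have := weakEquivalence_cokernel_π (pushout.inl i (coneι A)) hE
  refine weakEquivalence_of_postcomp_of_fac (g := suspObjToCokernelInl i) (fg := cokernel.π _) ?_
  apply pushout.hom_ext
  · rw [pushout.inl_desc_assoc, zero_comp, cokernel.condition]
  · rw [pushout.inr_desc_assoc, suspObjToCokernelInl, cokernel.π_desc]

/-- Two quotients of contractible objects by the same subobject are weakly equivalent. -/
lemma weakEquivalence_cokernel_map_of_contractible {A E T : C} (i : A ⟶ E) (t : A ⟶ T) (e : E ⟶ T)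
    (he : i ≫ e = t) [IsCofibrant A] [Cofibration i] [Cofibration t]
    (hE : WeakEquivalence (0 : E ⟶ (0 : C))) (hT : WeakEquivalence (0 : T ⟶ (0 : C))) :
    WeakEquivalence (cokernel.map i t (𝟙 A) e (by simp [he])) := by
  let m : mappingCone i ⟶ mappingCone t :=
    pushout.desc (e ≫ pushout.inl _ _) (pushout.inr _ _) (by
      rw [reassoc_of% he, pushout.condition])
  have hm₀ : pushout.inl _ _ ≫ m = e ≫ pushout.inl _ _ := pushout.inl_desc _ _ _
  have hm₁ : pushout.inr _ _ ≫ m = pushout.inr _ _ := pushout.inr_desc _ _ _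
  have := weakEquivalence_mappingConeToSuspObj i hE
  have := weakEquivalence_mappingConeToSuspObj t hT
  -- Both mapping cones collapse by weak equivalences onto the suspension of `A`, compatibly with
  -- `m`.
  have : WeakEquivalence m := weakEquivalence_of_postcomp_of_fac (f := m)
    (g := pushout.desc 0 (cokernel.π (coneι A)) _)
    (fg := pushout.desc 0 (cokernel.π (coneι A)) _) (by
      apply pushout.hom_ext
      · rw [reassoc_of% hm₀, pushout.inl_desc, pushout.inl_desc, comp_zero]
      · rw [reassoc_of% hm₁, pushout.inr_desc, pushout.inr_desc])
  have := weakEquivalence_mappingConeToCokernel i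
  have := weakEquivalence_mappingConeToCokernel t
  refine weakEquivalence_of_precomp_of_fac (f := mappingConeToCokernel i)
    (fg := m ≫ mappingConeToCokernel t) ?_
  apply pushout.hom_ext
  · rw [reassoc_of% inl_mappingConeToCokernel, reassoc_of% hm₀, inl_mappingConeToCokernel,
      cokernel.π_desc]
  · rw [reassoc_of% inr_mappingConeToCokernel, reassoc_of% hm₁, inr_mappingConeToCokernel, zero_comp]

end

variable {C : Type u} [Category.{v} C] [ModelCategory C] [HasZeroObject C] [HasZeroMorphisms C]
  {D : Type u'} [Category.{v'} D] [ModelCategory D] [HasZeroObject D] [HasZeroMorphisms D]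
  {F : C ⥤ D} {U : D ⥤ C} {adj : F ⊣ U} (h : IsQuillenPair adj)

namespace IsQuillenPair

include h

omit [HasZeroObject C] [HasZeroObject D] [HasZeroMorphisms C] [HasZeroMorphisms D] in
lemma isCofibrant_obj (A : C) [IsCofibrant A] : IsCofibrant (F.obj A) := by
  have := adj.leftAdjoint_preservesColimits
  have hi : IsInitial (F.obj (⊥_ C)) := IsInitial.isInitialObj F _ initialIsInitial
  have := h.cofibration_map (initial.to A) inferInstance
  have : IsCofibrant (F.obj (⊥_ C)) := by
    have : IsIso (initial.to (F.obj (⊥_ C))) :=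
      ⟨hi.to _, Subsingleton.elim _ _, hi.hom_ext _ _⟩
    infer_instance
  exact isCofibrant_of_cofibration (F.map (initial.to A))

lemma weakEquivalence_zero_obj {E : C} [IsCofibrant E] (hE : WeakEquivalence (0 : E ⟶ (0 : C))) :
    WeakEquivalence (0 : F.obj E ⟶ (0 : D)) := by
  have := adj.leftAdjoint_preservesColimits
  have h₀ : IsZero (F.obj (⊥_ C)) := (isZero_zero D).of_iso
    ((IsInitial.isInitialObj F _ initialIsInitial).uniqueUpToIso HasZeroObject.zeroIsInitial)
  have := weakEquivalence_initial_to hE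
  have := h.weakEquivalence_map (initial.to E) inferInstance inferInstance
  have : IsIso (0 : F.obj (⊥_ C) ⟶ (0 : D)) :=
    ⟨0, h₀.eq_of_src _ _, (isZero_zero D).eq_of_src _ _⟩
  exact weakEquivalence_of_precomp_of_fac (f := F.map (initial.to E)) (fg := 0) (by simp)

/-- On a cofibrant object, the left derived functor is given by `F`. -/
def leftDerivedObjIso (A : C) [IsCofibrant A] :
    h.leftDerived.obj ((toHo C).obj A) ≅ (toHo D).obj (F.obj A) :=
  haveI := h.isIso_leftDerivedCounit_app A
  asIso (h.leftDerivedCounit.app A)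

omit [HasZeroObject C] [HasZeroMorphisms C] [HasZeroObject D] [HasZeroMorphisms D] in
lemma leftDerivedObjIso_naturality {A B : C} [IsCofibrant A] [IsCofibrant B] (f : A ⟶ B) :
    h.leftDerived.map ((toHo C).map f) ≫ (h.leftDerivedObjIso B).hom =
      (h.leftDerivedObjIso A).hom ≫ (toHo D).map (F.map f) :=
  h.leftDerivedCounit.naturality f

/-- The left derived functor preserves cofiber sequences. -/
lemma isCofiberSequence_map {X Y Z : Ho C} {f : X ⟶ Y} {g : Y ⟶ Z} (H : IsCofiberSequence f g) :
    IsCofiberSequence (h.leftDerived.map f) (h.leftDerived.map g) := by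
  have := adj.isLeftAdjoint
  obtain ⟨A, B, i, _, _, a, b, c, hf, hg⟩ := H
  have : IsCofibrant B := isCofibrant_of_cofibration i
  have := isCofibrant_cokernel i
  refine ⟨F.obj A, F.obj B, F.map i, h.isCofibrant_obj A, h.cofibration_map i inferInstance,
    h.leftDerived.mapIso a ≪≫ h.leftDerivedObjIso A,
    h.leftDerived.mapIso b ≪≫ h.leftDerivedObjIso B,
    h.leftDerived.mapIso c ≪≫ h.leftDerivedObjIso _ ≪≫
      (toHo D).mapIso (PreservesCokernel.iso F i), ?_, ?_⟩
  · simp only [Iso.trans_hom, Functor.mapIso_hom, ← Functor.map_comp_assoc, hf, Category.assoc]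
    simp only [Functor.map_comp, Category.assoc, leftDerivedObjIso_naturality]
  · simp only [Iso.trans_hom, Functor.mapIso_hom, ← Functor.map_comp_assoc, hg, Category.assoc]
    simp only [Functor.map_comp, Category.assoc, reassoc_of% h.leftDerivedObjIso_naturality,
      ← PreservesCokernel.π_iso_hom]

lemma exists_coneComparison (A : C) [IsCofibrant A] :
    ∃ e : F.obj (cone A) ⟶ cone (F.obj A), F.map (coneι A) ≫ e = coneι (F.obj A) :=
  haveI := h.cofibration_map (coneι A) inferInstance
  exists_extension _ _ (isContractibleFibrant_cone _)

/-- The comparison of the image of a cone with the cone of the image. -/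
def coneComparison (A : C) [IsCofibrant A] : F.obj (cone A) ⟶ cone (F.obj A) :=
  (h.exists_coneComparison A).choose

@[simp]
lemma map_coneι_coneComparison (A : C) [IsCofibrant A] :
    F.map (coneι A) ≫ h.coneComparison A = coneι (F.obj A) :=
  (h.exists_coneComparison A).choose_spec

/-- The comparison of the quotients of the cones. -/
def suspComparison (A : C) [IsCofibrant A] : cokernel (F.map (coneι A)) ⟶ suspObj (F.obj A) :=
  cokernel.map _ _ (𝟙 _) (h.coneComparison A) (by simp)

/-- The image of the cone on `A` and the cone on the image of `A` are two contractible objects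
containing `F.obj A` by cofibrations. -/
instance (A : C) [IsCofibrant A] : WeakEquivalence (h.suspComparison A) := by
  have := h.isCofibrant_obj A
  have := h.cofibration_map (coneι A) inferInstance
  exact weakEquivalence_cokernel_map_of_contractible _ _ _ (h.map_coneι_coneComparison A)
    (h.weakEquivalence_zero_obj (weakEquivalence_zero_cone A)) (weakEquivalence_zero_cone _)

/-- The choices of cone maps and comparisons need not commute strictly. Both composites extend the
same morphism to a contractible target, which suffices by `toHo_map_cokernel_map_eq`. -/
lemma toHo_map_suspComparison_naturality {A B : C} [IsCofibrant A] [IsCofibrant B] (f : A ⟶ B) :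
    haveI := adj.isLeftAdjoint
    (toHo D).map (F.map (suspMap f)) ≫ (toHo D).map (PreservesCokernel.iso F (coneι B)).hom ≫
      (toHo D).map (h.suspComparison B) =
    (toHo D).map (PreservesCokernel.iso F (coneι A)).hom ≫ (toHo D).map (h.suspComparison A) ≫
      (toHo D).map (suspMap (F.map f)) := by
  have := adj.isLeftAdjoint
  have := h.cofibration_map (coneι A) inferInstance
  have e₁ : F.map (coneι A) ≫ F.map (coneMap f) ≫ h.coneComparison B =
      F.map f ≫ coneι (F.obj B) := by
    rw [← Functor.map_comp_assoc, coneι_coneMap, Functor.map_comp_assoc,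
      map_coneι_coneComparison]
  have e₂ : F.map (coneι A) ≫ h.coneComparison A ≫ coneMap (F.map f) =
      F.map f ≫ coneι (F.obj B) := by
    rw [reassoc_of% h.map_coneι_coneComparison, coneι_coneMap]
  have key := toHo_map_cokernel_map_eq _ _ (F.map f) (isContractibleFibrant_cone _) _ _ e₁ e₂
  have hA : F.map (suspMap f) ≫ (PreservesCokernel.iso F (coneι B)).hom ≫ h.suspComparison B =
      (PreservesCokernel.iso F (coneι A)).hom ≫ cokernel.map _ _ _ _ e₁ := by
    rw [← cancel_epi (F.map (cokernel.π (coneι A)))]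
    simp only [← Functor.map_comp_assoc, PreservesCokernel.π_iso_hom_assoc, suspMap]
    simp [suspComparison]
  have hB : (PreservesCokernel.iso F (coneι A)).hom ≫ h.suspComparison A ≫ suspMap (F.map f) =
      (PreservesCokernel.iso F (coneι A)).hom ≫ cokernel.map _ _ _ _ e₂ := by
    rw [← cancel_epi (F.map (cokernel.π (coneι A)))]
    simp [suspComparison, suspMap]
  rw [← Functor.map_comp, ← Functor.map_comp, ← Functor.map_comp, ← Functor.map_comp, hA, hB,
    Functor.map_comp, key, Functor.map_comp]

/-- The left derived functor of the suspension of a cofibrant object is the suspension of its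
image. -/
def leftDerivedSuspensionObjIso (A : C) [IsCofibrant A] :
    h.leftDerived.obj ((suspension C).obj ((toHo C).obj A)) ≅ (toHo D).obj (suspObj (F.obj A)) :=
  haveI := adj.isLeftAdjoint
  haveI := isCofibrant_cokernel (coneι A)
  haveI := isIso_toHo_map (h.suspComparison A)
  h.leftDerived.mapIso (suspensionIso A) ≪≫ h.leftDerivedObjIso _ ≪≫
    (toHo D).mapIso (PreservesCokernel.iso F (coneι A)) ≪≫
      asIso ((toHo D).map (h.suspComparison A))

lemma leftDerivedSuspensionObjIso_naturality {A B : C} [IsCofibrant A] [IsCofibrant B]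
    (f : A ⟶ B) :
    h.leftDerived.map ((suspension C).map ((toHo C).map f)) ≫
        (h.leftDerivedSuspensionObjIso B).hom =
      (h.leftDerivedSuspensionObjIso A).hom ≫ (toHo D).map (suspMap (F.map f)) := by
  have := adj.isLeftAdjoint
  have := isCofibrant_cokernel (coneι A)
  have := isCofibrant_cokernel (coneι B)
  have e₁ := congrArg h.leftDerived.map (suspensionIso_naturality f)
  have e₂ := h.leftDerivedObjIso_naturality (suspMap f)
  have e₃ := h.toHo_map_suspComparison_naturality f
  simp only [Functor.map_comp] at e₁
  simp only [leftDerivedSuspensionObjIso, Iso.trans_hom, Functor.mapIso_hom, asIso_hom,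
    Category.assoc, reassoc_of% e₁, reassoc_of% e₂, e₃]

omit [HasZeroObject C] [HasZeroMorphisms C] in
/-- The suspension of the left derived functor on a cofibrant object. -/
def suspensionLeftDerivedObjIso (A : C) [IsCofibrant A] :
    (suspension D).obj (h.leftDerived.obj ((toHo C).obj A)) ≅ (toHo D).obj (suspObj (F.obj A)) :=
  haveI := h.isCofibrant_obj A
  (suspension D).mapIso (h.leftDerivedObjIso A) ≪≫ suspensionIso _

omit [HasZeroObject C] [HasZeroMorphisms C] in
lemma suspensionLeftDerivedObjIso_naturality {A B : C} [IsCofibrant A] [IsCofibrant B]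
    (f : A ⟶ B) :
    (suspension D).map (h.leftDerived.map ((toHo C).map f)) ≫
        (h.suspensionLeftDerivedObjIso B).hom =
      (h.suspensionLeftDerivedObjIso A).hom ≫ (toHo D).map (suspMap (F.map f)) := by
  have := h.isCofibrant_obj A
  have := h.isCofibrant_obj B
  have e := congrArg (suspension D).map (h.leftDerivedObjIso_naturality f)
  simp only [Functor.map_comp] at e
  simp only [suspensionLeftDerivedObjIso, Iso.trans_hom, Functor.mapIso_hom, Category.assoc,
    reassoc_of% e, suspensionIso_naturality]

/-- The left derived functor commutes with the suspension. -/
lemma nonempty_leftDerivedSuspensionIso :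
    Nonempty (suspension C ⋙ h.leftDerived ≅ h.leftDerived ⋙ suspension D) := by
  let τ : (CofibrantObject.ι ⋙ toHo C) ⋙ suspension C ⋙ h.leftDerived ⟶
      (CofibrantObject.ι ⋙ toHo C) ⋙ h.leftDerived ⋙ suspension D :=
    { app A := (h.leftDerivedSuspensionObjIso A.obj).hom ≫
        (h.suspensionLeftDerivedObjIso A.obj).inv
      naturality A B f := by
        have e₁ := h.leftDerivedSuspensionObjIso_naturality f.hom
        have e₂ := h.suspensionLeftDerivedObjIso_naturality f.hom
        dsimp
        rw [← cancel_mono (h.suspensionLeftDerivedObjIso B.obj).hom]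
        simp only [Category.assoc, Iso.inv_hom_id, Category.comp_id, e₁, e₂,
          Iso.inv_hom_id_assoc] }
  obtain ⟨γ, hγ⟩ := exists_natTrans_app τ
  have : IsIso γ := by
    rw [NatTrans.isIso_iff_isIso_app]
    intro X
    obtain ⟨A, _, _, ⟨e⟩⟩ := exists_cofibrant_fibrant_iso X
    rw [NatTrans.isIso_app_iff_of_iso γ e]
    have := hγ (CofibrantObject.mk A)
    dsimp [τ] at this
    rw [this]
    infer_instance
  exact ⟨asIso γ⟩

end IsQuillenPair

end LeftDerivedTriangulated

/-! ### Compact objects under adjunctions, and detection of isomorphisms by generators -/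

section Compactness

section

variable {T : Type u} [Category.{v} T] [Preadditive T]
  {T' : Type u'} [Category.{v'} T'] [Preadditive T']

open Classical in
@[simp]
lemma directSumToHom_of (X : T) {I : Type w} {A : I → T} (c : Cofan A) (i : I) (u : X ⟶ A i) :
    directSumToHom X c (DirectSum.of (fun i => (X ⟶ A i)) i u) = u ≫ c.inj i := by
  simp [directSumToHom, Preadditive.rightComp]

lemma directSumToHom_comp (X : T) {I : Type w} {A : I → T} (c c' : Cofan A) (φ : c.pt ⟶ c'.pt)
    (hφ : ∀ i, c.inj i ≫ φ = c'.inj i) (x : ⨁ i, (X ⟶ A i)) :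
    directSumToHom X c x ≫ φ = directSumToHom X c' x := by
  classical
  refine DFunLike.congr_fun (f := (Preadditive.rightComp X φ).comp (directSumToHom X c))
    (DirectSum.addHom_ext (fun i u => ?_)) x
  simp [hφ, Preadditive.rightComp]

/-- The comparison with the direct sum is invariant under isomorphisms of groups of morphisms. -/
lemma bijective_directSumToHom_iff {X : T} {X' : T'} {I : Type w} {A : I → T} {A' : I → T'}
    (c : Cofan A) (c' : Cofan A') (e : ∀ i, (X ⟶ A i) ≃+ (X' ⟶ A' i))
    (e' : (X ⟶ c.pt) ≃+ (X' ⟶ c'.pt)) (h : ∀ i u, e' (u ≫ c.inj i) = e i u ≫ c'.inj i) :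
    Function.Bijective (directSumToHom X c) ↔ Function.Bijective (directSumToHom X' c') := by
  classical
  refine bijective_iff_of_equiv (DFinsupp.mapRange.addEquiv e).toEquiv e'.toEquiv (fun x => ?_)
  refine DFunLike.congr_fun (f := e'.toAddMonoidHom.comp (directSumToHom X c))
    (g := (directSumToHom X' c').comp (DFinsupp.mapRange.addEquiv e).toAddMonoidHom)
    (DirectSum.addHom_ext (fun i u => ?_)) x
  have : DFinsupp.mapRange.addEquiv e (DirectSum.of (fun i => (X ⟶ A i)) i u) =
      DirectSum.of (fun i => (X' ⟶ A' i)) i (e i u) :=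
    DFinsupp.mapRange_single (f := fun i => e i) (hf := fun i => (e i).map_zero)
  simp [this, h]

lemma IsCompactObject.of_iso {X Y : T} (hX : IsCompactObject.{w} X) (e : X ≅ Y) :
    IsCompactObject.{w} Y := fun I A c hc =>
  (bijective_directSumToHom_iff c c
    (fun i => { e.homCongr (Iso.refl (A i)) with map_add' := by simp })
    { e.homCongr (Iso.refl c.pt) with map_add' := by simp } (by simp)).1 (hX I A c hc)

variable {G : T ⥤ T'} {H : T' ⥤ T} (adj : G ⊣ H) [G.Additive]

include adj

lemma bijective_directSumToHom_obj_iff (X : T) {I : Type w} {A : I → T'} (c : Cofan A) :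
    Function.Bijective (directSumToHom (G.obj X) c) ↔
      Function.Bijective (directSumToHom X
        (Cofan.mk (H.obj c.pt) (fun i => H.map (c.inj i)) : Cofan (fun i => H.obj (A i)))) :=
  bijective_directSumToHom_iff c _ (fun i => adj.homAddEquiv X (A i))
    (adj.homAddEquiv X c.pt) (fun _ u => adj.homEquiv_naturality_right u _)

lemma IsCompactObject.obj_of_adjunction {X : T} (hX : IsCompactObject.{w} X)
    (hH : PreservesCoproducts.{w} H) : IsCompactObject.{w} (G.obj X) := fun I A c hc => by
  have := hH I
  rw [bijective_directSumToHom_obj_iff adj]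
  exact hX I _ _ (Cofan.isColimitMapCoconeEquiv H A c (isColimitOfPreserves H hc))

end

/-- The right adjoint preserves binary products, hence is additive for any preadditive structures,
and additivity passes to its left adjoint. The structures obtained from `nonempty_preadditive` thus
need no compatibility. -/
lemma additive_left_of_adjunction {T : Type u} [Category.{v} T] [Preadditive T]
    {T' : Type u'} [Category.{v'} T'] [Preadditive T'] [HasCoproducts.{w} T']
    {G : T ⥤ T'} {H : T' ⥤ T} (adj : G ⊣ H) : G.Additive := by
  have := hasFiniteCoproducts_of_hasCoproducts.{w} T'
  have := HasFiniteBiproducts.of_hasFiniteCoproducts (C := T')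
  have : PreservesLimitsOfSize.{0, 0} H := adj.rightAdjoint_preservesLimits
  have := adj.isRightAdjoint
  have : H.Additive := Functor.additive_of_preserves_binary_products H
  exact adj.left_adjoint_additive

lemma IsHomotopicallyCompact.obj_of_adjunction {C : Type u} [Category.{v} C] [ModelCategory C]
    [HasZeroObject C] [HasZeroMorphisms C] [IsStable C]
    {D : Type u'} [Category.{v'} D] [ModelCategory D] [HasCoproducts.{w} D]
    {G : Ho C ⥤ Ho D} {H : Ho D ⥤ Ho C} (adj : G ⊣ H) {X : Ho C}
    (hX : IsHomotopicallyCompact.{w} X) (hH : PreservesCoproducts.{w} H) :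
    IsHomotopicallyCompact.{w} (G.obj X) := fun _ => by
  obtain ⟨i⟩ := nonempty_preadditive C
  have := additive_left_of_adjunction.{w} adj
  exact (hX i).obj_of_adjunction adj hH

lemma IsHomotopicallyCompact.of_iso {C : Type u} [Category.{v} C] [ModelCategory C] {X Y : Ho C}
    (hX : IsHomotopicallyCompact.{w} X) (e : X ≅ Y) : IsHomotopicallyCompact.{w} Y :=
  fun i => (hX i).of_iso e

lemma IsHomotopicallyCompact.obj_of_equivalence {C : Type u} [Category.{v} C] [ModelCategory C]
    [HasZeroObject C] [HasZeroMorphisms C] [IsStable C] [HasCoproducts.{w} C]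
    (e : Ho C ≌ Ho C) {X : Ho C} (hX : IsHomotopicallyCompact.{w} X) :
    IsHomotopicallyCompact.{w} (e.functor.obj X) :=
  hX.obj_of_adjunction e.toAdjunction (fun _ => inferInstance)

/-- A morphism which is inverted by the morphisms out of a class of objects which is closed under
suspension and desuspension and contains a set of generators is an isomorphism. -/
lemma IsGeneratingSet.isIso_of_closed {C : Type u} [Category.{v} C] [ModelCategory C]
    [HasZeroObject C] [HasZeroMorphisms C] [IsStable C] {K : Set C}
    (hK : IsGeneratingSet.{w} K) (e : Ho C ≌ Ho C) (he : e.functor = suspension C)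
    (S : ObjectProperty (Ho C)) (hS : ∀ X, S X → S (e.functor.obj X))
    (hS' : ∀ X, S X → S (e.inverse.obj X)) (hKS : ∀ k ∈ K, S ((toHo C).obj k))
    {A B : Ho C} (φ : A ⟶ B)
    (hφ : ∀ X, S X → Function.Bijective (fun u : X ⟶ A => u ≫ φ)) : IsIso φ := by
  obtain ⟨_⟩ := nonempty_preadditive C
  -- All morphisms seen as bijections by `S` are considered together, not `φ` alone: this class is
  -- stable under suspension, so its colocal objects form a localising subcategory containing `K`.
  let Φ : MorphismProperty (Ho C) := fun A B φ => ∀ X, S X →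
    Function.Bijective (fun u : X ⟶ A => u ≫ φ)
  refine isIso_of_yoneda_map_bijective φ (fun X => hK _
    (isLocalising_isColocal e he Φ ?_ ?_) (fun k hk _ _ ψ hψ => hψ _ (hKS k hk)) X φ hφ)
  · intro A B ψ hψ X hX
    exact (bijective_comp_map_iff e.symm.toAdjunction X ψ).1 (hψ _ (hS' X hX))
  · intro A B ψ hψ X hX
    exact (bijective_comp_map_iff e.toAdjunction X ψ).1 (hψ _ (hS X hX))

variable (C : Type u) [Category.{v} C] [ModelCategory C] [HasZeroObject C] [HasZeroMorphisms C]
  [IsStable C]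

/-- The suspension as an autoequivalence. -/
def suspensionEquiv : Ho C ≌ Ho C :=
  haveI := IsStable.isEquivalence_suspension (C := C)
  (suspension C).asEquivalence

end Compactness

/-! ### Preservation of coproducts by the right derived functor -/

section PreservesCoproducts

variable {C : Type u} [Category.{v} C] [ModelCategory C] [HasZeroObject C] [HasZeroMorphisms C]
  [IsStable C]
  {D : Type u'} [Category.{v'} D] [ModelCategory D] [HasZeroObject D] [HasZeroMorphisms D]
  [IsStable D]
  {F : C ⥤ D} {U : D ⥤ C} {adj : F ⊣ U} (h : IsQuillenPair adj)

namespace IsQuillenPair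

include h

lemma nonempty_suspensionIso (X : Ho C) : Nonempty
    (h.leftDerived.obj ((suspensionEquiv C).functor.obj X) ≅
      (suspensionEquiv D).functor.obj (h.leftDerived.obj X)) :=
  h.nonempty_leftDerivedSuspensionIso.map fun e => e.app X

lemma nonempty_desuspensionIso (X : Ho C) : Nonempty
    (h.leftDerived.obj ((suspensionEquiv C).inverse.obj X) ≅
      (suspensionEquiv D).inverse.obj (h.leftDerived.obj X)) := by
  obtain ⟨e⟩ := h.nonempty_suspensionIso ((suspensionEquiv C).inverse.obj X)
  exact ⟨(suspensionEquiv D).unitIso.app _ ≪≫ (suspensionEquiv D).inverse.mapIso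
    (e.symm ≪≫ h.leftDerived.mapIso ((suspensionEquiv C).counitIso.app X))⟩

/-- The right derived functor preserves coproducts if and only if the left derived functor
sends compact generators to compact objects. -/
theorem preservesCoproducts_rightDerived_iff [HasCoproducts.{w} C] [HasCoproducts.{w} D]
    {K : Set C} (hK : IsGeneratingSet.{w} K)
    (hKc : ∀ k ∈ K, IsHomotopicallyCompact.{w} ((toHo C).obj k)) :
    PreservesCoproducts.{w} h.rightDerived ↔
      ∀ k ∈ K, IsHomotopicallyCompact.{w} (h.leftDerived.obj ((toHo C).obj k)) := by
  refine ⟨fun hR k hk => (hKc k hk).obj_of_adjunction h.derivedAdjunction hR,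
    fun hL I => ?_⟩
  obtain ⟨_⟩ := nonempty_preadditive C
  obtain ⟨_⟩ := nonempty_preadditive D
  have := additive_left_of_adjunction.{w} h.derivedAdjunction
  have (B : I → Ho D) : PreservesColimit (Discrete.functor B) h.rightDerived := by
    have : IsIso (sigmaComparison h.rightDerived B) := by
      refine hK.isIso_of_closed (suspensionEquiv C) rfl (fun X => IsHomotopicallyCompact.{w} X ∧
        IsHomotopicallyCompact.{w} (h.leftDerived.obj X)) ?_ ?_
        (fun k hk => ⟨hKc k hk, hL k hk⟩) _ ?_
      · rintro X ⟨h₁, h₂⟩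
        exact ⟨h₁.obj_of_equivalence _,
          (h₂.obj_of_equivalence _).of_iso (h.nonempty_suspensionIso X).some.symm⟩
      · rintro X ⟨h₁, h₂⟩
        exact ⟨h₁.obj_of_equivalence (suspensionEquiv C).symm,
          (h₂.obj_of_equivalence (suspensionEquiv D).symm).of_iso
            (h.nonempty_desuspensionIso X).some.symm⟩
      · rintro X ⟨h₁, h₂⟩
        let c := Cofan.mk (∐ B) (Sigma.ι B)
        let c' := Cofan.mk (∐ fun i => h.rightDerived.obj (B i)) (Sigma.ι _)
        have b₁ := h₁ inferInstance I _ c' (coproductIsCoproduct _)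
        have b₂ := h₂ inferInstance I B c (coproductIsCoproduct B)
        rw [bijective_directSumToHom_obj_iff h.derivedAdjunction] at b₂
        -- After the bijection `b₁`, composition with the comparison becomes the direct sum map into
        -- RU of the coproduct. By adjunction this is the direct sum map for LF X, bijective by
        -- compactness.
        rw [← Function.Bijective.of_comp_iff _ b₁]
        have e := funext (directSumToHom_comp X c' _ _
          (ι_comp_sigmaComparison h.rightDerived B) : ∀ x, _ =
            directSumToHom X (Cofan.mk (h.rightDerived.obj c.pt)
              (fun i => h.rightDerived.map (c.inj i))) x)
        rw [← e] at b₂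
        exact b₂
    exact PreservesCoproduct.of_iso_comparison _ _
  exact preservesColimitsOfShape_of_discrete _

end IsQuillenPair

end PreservesCoproducts

/-! ### From generators to a Quillen equivalence -/

section QuillenEquivalence

/-- Under the adjunction bijection, the action of `G` on morphisms into `X` is composition with the
unit. This form passes to suspensions without any compatibility between the unit and the suspension
isomorphism. -/
lemma isIso_unit_app_iff {T : Type u} [Category.{v} T] {T' : Type u'} [Category.{v'} T']
    {G : T ⥤ T'} {H : T' ⥤ T} (adj : G ⊣ H) (X : T) :
    IsIso (adj.unit.app X) ↔
      ∀ S : T, Function.Bijective (G.map : (S ⟶ X) → (G.obj S ⟶ G.obj X)) := by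
  rw [isIso_iff_yoneda_map_bijective]
  refine forall_congr' fun S => ?_
  rw [← Function.Bijective.of_comp_iff' (adj.homEquiv S (G.obj X)).bijective]
  refine iff_of_eq (congrArg _ (funext fun u => ?_))
  simp [Adjunction.homEquiv_unit]

/-- A functor which commutes with autoequivalences is fully faithful at an object if and only if
it is at its image. -/
lemma forall_bijective_map_iff {T : Type u} [Category.{v} T] {T' : Type u'} [Category.{v'} T']
    {G : T ⥤ T'} (e : T ≌ T) (e' : T' ≌ T') (γ : e.functor ⋙ G ≅ G ⋙ e'.functor) (X : T) :
    (∀ S : T, Function.Bijective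
      (G.map : (S ⟶ e.functor.obj X) → (G.obj S ⟶ G.obj (e.functor.obj X)))) ↔
      ∀ S : T, Function.Bijective (G.map : (S ⟶ X) → (G.obj S ⟶ G.obj X)) := by
  have key (S : T) : Function.Bijective
      (G.map : (S ⟶ X) → (G.obj S ⟶ G.obj X)) ↔ Function.Bijective (G.map :
        (e.functor.obj S ⟶ e.functor.obj X) → _) :=
    bijective_iff_of_equiv e.fullyFaithfulFunctor.homEquiv
      (e'.fullyFaithfulFunctor.homEquiv.trans ((γ.symm.app S).homCongr (γ.symm.app X)))
      (fun u => by
        have := γ.hom.naturality u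
        dsimp at this
        simp [Functor.FullyFaithful.homEquiv, Iso.homCongr, ← reassoc_of% this])
  refine ⟨fun h S => (key S).2 (h _), fun h S => ?_⟩
  refine (bijective_iff_of_equiv ((e.counitIso.app S).symm.homCongr (Iso.refl _))
    ((G.mapIso (e.counitIso.app S)).symm.homCongr (Iso.refl _)) (fun u => ?_)).2
      ((key (e.inverse.obj S)).1 (h _))
  simp [Iso.homCongr]

/-- This replaces exactness of RU: a right adjoint preserves weak kernels formally, so RU need not
be shown to preserve cofiber sequences. -/
lemma IsWeakKernel.map_of_adjunction {T : Type u} [Category.{v} T] [HasZeroMorphisms T]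
    {T' : Type u'} [Category.{v'} T'] [HasZeroMorphisms T'] {G : T ⥤ T'} {H : T' ⥤ T}
    (adj : G ⊣ H) [G.PreservesZeroMorphisms] [H.PreservesZeroMorphisms] {X Y Z : T'} {f : X ⟶ Y}
    {g : Y ⟶ Z} (h : IsWeakKernel f g) : IsWeakKernel (H.map f) (H.map g) where
  zero := by rw [← H.map_comp, h.zero, H.map_zero]
  exists_lift {W} u hu := by
    obtain ⟨v, hv⟩ := h.exists_lift ((adj.homEquiv _ _).symm u) (by
      rw [← adj.homEquiv_naturality_right_symm, hu, Adjunction.homEquiv_counit, G.map_zero,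
        zero_comp])
    exact ⟨adj.homEquiv _ _ v, by
      rw [← adj.homEquiv_naturality_right, hv, Equiv.apply_symm_apply]⟩

variable {C : Type u} [Category.{v} C] [ModelCategory C] {D : Type u'} [Category.{v'} D]
  [ModelCategory D] {F : C ⥤ D} {U : D ⥤ C} {adj : F ⊣ U} (h : IsQuillenPair adj)

namespace IsQuillenPair

include h

lemma isIso_derivedAdjunction_unit_app (A : C) (hA : WeakEquivalence (derivedUnit adj A)) :
    IsIso (h.derivedAdjunction.unit.app ((toHo C).obj A)) := by
  have := isIso_toHo_map (cofRepHom A)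
  rw [← NatTrans.isIso_app_iff_of_iso _ (asIso ((toHo C).map (cofRepHom A)))]
  have := h.isIso_leftDerivedCounit_app (cofRep A)
  have := isIso_toHo_map (fibRepHom (F.obj (cofRep A)))
  have := isIso_toHo_map (derivedUnit adj A)
  have := h.isIso_rightDerivedUnit_app (fibRep (F.obj (cofRep A)))
  have e : h.derivedAdjunction.unit.app ((toHo C).obj (cofRep A)) ≫
      h.rightDerived.map (h.leftDerivedCounit.app (cofRep A)) ≫
        h.rightDerived.map ((toHo D).map (fibRepHom (F.obj (cofRep A)))) =
      (toHo C).map (derivedUnit adj A) ≫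
        h.rightDerivedUnit.app (fibRep (F.obj (cofRep A))) := by
    have n := h.rightDerivedUnit.naturality (fibRepHom (F.obj (cofRep A)))
    dsimp at n
    rw [reassoc_of% h.derivedAdjunction_unit_app, derivedUnit, Functor.map_comp, Category.assoc, n]
  exact (isIso_comp_right_iff _ (h.rightDerived.map (h.leftDerivedCounit.app (cofRep A)) ≫
    h.rightDerived.map ((toHo D).map (fibRepHom (F.obj (cofRep A)))))).1 (e ▸ inferInstance)

lemma isIso_derivedAdjunction_counit_app (B : D) (hB : WeakEquivalence (derivedCounit adj B)) :
    IsIso (h.derivedAdjunction.counit.app ((toHo D).obj B)) := by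
  have := isIso_toHo_map (fibRepHom B)
  rw [NatTrans.isIso_app_iff_of_iso _ (asIso ((toHo D).map (fibRepHom B)))]
  have := h.isIso_rightDerivedUnit_app (fibRep B)
  have := isIso_toHo_map (cofRepHom (U.obj (fibRep B)))
  have := isIso_toHo_map (derivedCounit adj B)
  have := h.isIso_leftDerivedCounit_app (cofRep (U.obj (fibRep B)))
  have e : (h.leftDerived.map ((toHo C).map (cofRepHom (U.obj (fibRep B)))) ≫
      h.leftDerived.map (h.rightDerivedUnit.app (fibRep B))) ≫
        h.derivedAdjunction.counit.app ((toHo D).obj (fibRep B)) =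
      h.leftDerivedCounit.app (cofRep (U.obj (fibRep B))) ≫
        (toHo D).map (derivedCounit adj B) := by
    have n := h.leftDerivedCounit.naturality (cofRepHom (U.obj (fibRep B)))
    dsimp at n
    rw [Category.assoc, derivedAdjunction_counit_app, derivedCounit, Functor.map_comp,
      reassoc_of% n]
  exact (isIso_comp_left_iff (h.leftDerived.map ((toHo C).map (cofRepHom (U.obj (fibRep B)))) ≫
    h.leftDerived.map (h.rightDerivedUnit.app (fibRep B))) _).1 (e ▸ inferInstance)

/-- Up to invertible comparisons, the adjunct of `f` in the homotopy category is the derived unit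
followed by RU of `f`. As the unit is invertible and RU is fully faithful, one is invertible exactly
when the other is; weak equivalences are detected in the homotopy category. -/
lemma isQuillenEquivalence_of_isIso [IsIso h.derivedAdjunction.unit]
    [IsIso h.derivedAdjunction.counit] : IsQuillenEquivalence adj where
  isQuillenPair := h
  weakEquivalence_iff X Y _ _ f := by
    have := h.derivedAdjunction.fullyFaithfulROfIsIsoCounit.full
    have := h.derivedAdjunction.fullyFaithfulROfIsIsoCounit.faithful
    have := h.isIso_leftDerivedCounit_app X
    have := h.isIso_rightDerivedUnit_app Y
    have e : (toHo C).map (adj.homEquiv X Y f) ≫ h.rightDerivedUnit.app Y =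
        (h.derivedAdjunction.unit.app ((toHo C).obj X) ≫
          h.rightDerived.map (h.leftDerivedCounit.app X)) ≫
            h.rightDerived.map ((toHo D).map f) := by
      have n := h.rightDerivedUnit.naturality f
      dsimp at n
      rw [derivedAdjunction_unit_app, Adjunction.homEquiv_unit, Functor.map_comp,
        Category.assoc, Category.assoc, n]
    rw [← isIso_toHo_map_iff, ← isIso_toHo_map_iff,
      ← isIso_comp_right_iff ((toHo C).map (adj.homEquiv X Y f)) (h.rightDerivedUnit.app Y), e,
      isIso_comp_left_iff]
    exact ⟨fun _ => inferInstance, fun _ => isIso_of_reflects_iso _ h.rightDerived⟩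

end IsQuillenPair

variable [HasZeroObject C] [HasZeroMorphisms C] [IsStable C] [HasZeroObject D]
  [HasZeroMorphisms D] [IsStable D]

namespace IsQuillenPair

include h

lemma isLocalising_isIso_unit (hR : PreservesCoproducts.{w} h.rightDerived) :
    IsLocalising.{w} (fun X : Ho C => IsIso (h.derivedAdjunction.unit.app X)) := by
  obtain ⟨_⟩ := nonempty_preadditive C
  obtain ⟨_⟩ := nonempty_preadditive D
  have := h.derivedAdjunction.isLeftAdjoint
  have := h.derivedAdjunction.isRightAdjoint
  have hs (X : Ho C) : IsIso (h.derivedAdjunction.unit.app ((suspension C).obj X)) ↔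
      IsIso (h.derivedAdjunction.unit.app X) := by
    obtain ⟨γ⟩ := h.nonempty_leftDerivedSuspensionIso
    rw [isIso_unit_app_iff, isIso_unit_app_iff]
    exact forall_bijective_map_iff (suspensionEquiv C) (suspensionEquiv D) γ X
  refine .of_cofiber (fun X hX => ?_) hs (fun {X Y Z} f g H hX hY => ?_) (fun I => ⟨?_⟩)
  · have hX' := h.rightDerived.map_isZero (h.leftDerived.map_isZero hX)
    exact ⟨hX'.to_ _, hX.eq_of_src _ _, hX'.eq_of_src _ _⟩
  · obtain ⟨δ, H₁⟩ := H.rotate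
    obtain ⟨ε, H₂⟩ := H₁.rotate
    have w {X Y Z : Ho C} {f : X ⟶ Y} {g : Y ⟶ Z} (H : IsCofiberSequence f g) :
        IsWeakKernel (h.rightDerived.map (h.leftDerived.map f))
          (h.rightDerived.map (h.leftDerived.map g)) :=
      (h.isCofiberSequence_map H).isWeakKernel.map_of_adjunction h.derivedAdjunction
    have n {X Y : Ho C} (f : X ⟶ Y) := h.derivedAdjunction.unit.naturality f
    let V : Fin 5 → Ho C := ![X, Y, Z, (suspension C).obj X, (suspension C).obj Y]
    have : IsIso (h.derivedAdjunction.unit.app (V 0)) := hX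
    have : IsIso (h.derivedAdjunction.unit.app (V 1)) := hY
    have : IsIso (h.derivedAdjunction.unit.app (V 3)) := (hs X).2 hX
    have : IsIso (h.derivedAdjunction.unit.app (V 4)) := (hs Y).2 hY
    -- The five lemma compares `X ⟶ Y ⟶ Z ⟶ ΣX ⟶ ΣY` with its image under RU ∘ LF, through the unit.
    exact isIso_of_isWeakKernel (X := V)
      (Y := fun i => h.rightDerived.obj (h.leftDerived.obj (V i))) H.isWeakKernel
      H₁.isWeakKernel H₂.isWeakKernel (w H) (w H₁) (w H₂)
      (fun i => h.derivedAdjunction.unit.app (V i)) (n f) (n g) (n δ) (n ε)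
  · rintro X ⟨p⟩
    have := hR I
    have : PreservesColimitsOfShape (Discrete I) h.leftDerived :=
      h.derivedAdjunction.leftAdjoint_preservesColimits.preservesColimitsOfShape
    have (j : Discrete I) := p.prop_diag_obj j
    have : IsIso (Functor.whiskerLeft p.diag h.derivedAdjunction.unit) := by
      rw [NatTrans.isIso_iff_isIso_app]
      exact this
    exact isIso_app_coconePt_of_preservesColimit p.diag h.derivedAdjunction.unit _ p.isColimit

/-- If the derived unit and counit are weak equivalences on generators and the right derived
functor preserves coproducts, then the Quillen pair is a Quillen equivalence. -/
theorem isQuillenEquivalence (hR : PreservesCoproducts.{w} h.rightDerived)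
    {K : Set C} (hK : IsGeneratingSet.{w} K) {L : Set D} (hL : IsGeneratingSet.{w} L)
    (hη : ∀ k ∈ K, WeakEquivalence (derivedUnit adj k))
    (hε : ∀ l ∈ L, WeakEquivalence (derivedCounit adj l)) : IsQuillenEquivalence adj := by
  have : IsIso h.derivedAdjunction.unit := by
    rw [NatTrans.isIso_iff_isIso_app]
    exact hK _ (h.isLocalising_isIso_unit hR)
      (fun k hk => h.isIso_derivedAdjunction_unit_app k (hη k hk))
  have : IsIso h.derivedAdjunction.counit := by
    rw [NatTrans.isIso_iff_isIso_app]
    intro Y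
    refine hL.isIso_of_closed (suspensionEquiv D) rfl h.leftDerived.essImage ?_ ?_ ?_ _ ?_
    · rintro X ⟨S, ⟨e⟩⟩
      exact ⟨_, ⟨(h.nonempty_suspensionIso S).some ≪≫ (suspensionEquiv D).functor.mapIso e⟩⟩
    · rintro X ⟨S, ⟨e⟩⟩
      exact ⟨_, ⟨(h.nonempty_desuspensionIso S).some ≪≫ (suspensionEquiv D).inverse.mapIso e⟩⟩
    · intro l hl
      have := h.isIso_derivedAdjunction_counit_app l (hε l hl)
      exact ⟨_, ⟨asIso (h.derivedAdjunction.counit.app ((toHo D).obj l))⟩⟩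
    · rintro X ⟨S, ⟨e⟩⟩
      refine (bijective_iff_of_equiv (e.symm.homCongr (Iso.refl _))
        (e.symm.homCongr (Iso.refl _)) (fun u => by simp [Iso.homCongr])).2 (?_ :
          Function.Bijective (fun u : h.leftDerived.obj S ⟶ _ =>
            u ≫ h.derivedAdjunction.counit.app Y))
      -- LF is bijective on these morphisms because the unit is invertible. Composing it with the
      -- counit gives the adjunction bijection, so composition with the counit is bijective too.
      rw [← Function.Bijective.of_comp_iff _
        ((isIso_unit_app_iff h.derivedAdjunction _).1 inferInstance S)]
      convert! (h.derivedAdjunction.homEquiv S Y).symm.bijective using 1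
  exact h.isQuillenEquivalence_of_isIso

end IsQuillenPair

end QuillenEquivalence

end StableModel

end

theorem mainTheorem10
    {C : Type u} [Category.{v} C] [ModelCategory C] [HasZeroObject C] [HasZeroMorphisms C]
    [HasCoproducts.{w} C] [StableModel.IsStable C]
    {D : Type u'} [Category.{v'} D] [ModelCategory D] [HasZeroObject D] [HasZeroMorphisms D]
    [HasCoproducts.{w} D] [StableModel.IsStable D]
    {F : C ⥤ D} {U : D ⥤ C} (adj : F ⊣ U) (h : StableModel.IsQuillenPair adj)
    (K : Set C) (hK : StableModel.IsGeneratingSet.{w} K)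
    (hKc : ∀ k ∈ K, StableModel.IsHomotopicallyCompact.{w} ((StableModel.toHo C).obj k))
    (L : Set D) (hL : StableModel.IsGeneratingSet.{w} L)
    (hLc : ∀ l ∈ L, StableModel.IsHomotopicallyCompact.{w} ((StableModel.toHo D).obj l)) :
    (StableModel.PreservesCoproducts.{w} h.rightDerived ↔
      ∀ k ∈ K, StableModel.IsHomotopicallyCompact.{w}
        (h.leftDerived.obj ((StableModel.toHo C).obj k))) ∧
    (StableModel.PreservesCoproducts.{w} h.rightDerived →
      (∀ k ∈ K, WeakEquivalence (StableModel.derivedUnit adj k)) →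
      (∀ l ∈ L, WeakEquivalence (StableModel.derivedCounit adj l)) →
      StableModel.IsQuillenEquivalence adj) :=
  ⟨h.preservesCoproducts_rightDerived_iff hK hKc,
    fun hR hη hε => h.isQuillenEquivalence hR hK hL hη hε⟩
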